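/- \textbf{General Scheduling Problem (GSP).} An instance consists of $n\ge 0$ jobs; job $j$ has an integer release time $r_j\ge 0$, an integer size $p_j\ge 1$, and weights $w_j(t)\in\mathbb{Z}_{\ge 0}$ for the integers $t>r_j$. A preemptive schedule on one processor assigns to each unit time slot $(s-1,s]$, $s=1,2,\dots$, at most one job; it is feasible if each job $j$ is processed in exactly $p_j$ slots, all of them with $s>r_j$. The completion time $C_j$ is the last slot $s$ in which $j$ is processed, and the cost of the schedule is $\sum_{j}\sum_{s=r_j+1}^{C_j}w_j(s)$. Let $R=\max_j r_j$, $P=\max_j p_j$, $T=R+\sum_j p_j$, and let $W$ be the maximum of $w_j(t)$ over all jobs $j$ and $r_j<t\le T$ (maxima over the empty set are $0$). An algorithm receives $n$, the $r_j$ and the $p_j$ explicitly. It accesses the weights through an oracle that, given $(j,k)$ with $k\ge 0$, returns the first time $t\in(r_j,T]$ at which the cost $\sum_{s=r_j+1}^{t}w_j(s)$ of completing job $j$ has reached $2^k$, or reports that there is none. Running time is measured on a random access machine with logarithmic cost, i.e. every operation is charged one plus the bit-lengths of the numbers involved, and an oracle query is charged in the same way for its arguments and its answer. A schedule is output as a list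 of blocks (job, start time, end time). \textbf{Theorem.} There is a (deterministic) algorithm that, on every GSP instance in which all release times are equal, runs in time polynomial in $n$ and the bit-lengths of $R$, $P$ and $W$ (hence polynomial in $n,\log P,\log W$ when all release times are $0$), and outputs a feasible schedule whose cost is at most $16$ times the cost of every feasible schedule. That is, GSP with identical release times has a polynomial-time $16$-approximation. -/

import Mathlib

/-! ### The general scheduling problem -/

/-- An instance of the general scheduling problem: `n` jobs, job `j` having release time `r j`,
positive integer size `p j`, and weights `w j t` (only the values at `t > r j` matter). -/
structure GSP where
  n : ℕ
  r : Fin n → ℕ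
  p : Fin n → ℕ
  p_pos : ∀ j, 0 < p j
  w : Fin n → ℕ → ℕ

namespace GSP

/-- A preemptive one-processor schedule. The time slot `s` is the unit interval `(s - 1, s]`;
`σ s = some j` means that job `j` is processed during that slot, `σ s = none` that the
processor is idle. -/
abbrev Schedule (I : GSP) : Type := ℕ → Option (Fin I.n)

/-- The slots in which `σ` processes job `j`. -/
def slots (I : GSP) (σ : I.Schedule) (j : Fin I.n) : Set ℕ := {s | σ s = some j}

/-- A job is processed only after its release time, for exactly `p j` slots in total. -/
structure Feasible (I : GSP) (σ : I.Schedule) : Prop where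
  released : ∀ j, ∀ s ∈ I.slots σ j, I.r j < s
  finite : ∀ j, (I.slots σ j).Finite
  processed : ∀ j, (I.slots σ j).ncard = I.p j

/-- The completion time of job `j`: the end of the last slot in which it is processed
(for a feasible schedule the set of slots is finite and non-empty). -/
noncomputable def completion (I : GSP) (σ : I.Schedule) (j : Fin I.n) : ℕ := sSup (I.slots σ j)

/-- The cost incurred by job `j` if it completes at time `t`. -/
def costAt (I : GSP) (j : Fin I.n) (t : ℕ) : ℕ := ∑ s ∈ Finset.Ioc (I.r j) t, I.w j s

/-- The total cost of a schedule. -/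
noncomputable def cost (I : GSP) (σ : I.Schedule) : ℕ := ∑ j, I.costAt j (I.completion σ j)

/-- The maximum release time. -/
def maxRelease (I : GSP) : ℕ := Finset.univ.sup I.r

/-- The maximum job size `P`. -/
def maxSize (I : GSP) : ℕ := Finset.univ.sup I.p

/-- The time horizon: a schedule that never idles needlessly is finished by this time. -/
def horizon (I : GSP) : ℕ := I.maxRelease + ∑ j, I.p j

/-- The maximum weight `W` (over the times up to the horizon, so that it always exists). -/
def maxWeight (I : GSP) : ℕ :=
  Finset.univ.sup fun j => (Finset.Ioc (I.r j) I.horizon).sup (I.w j)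

/-- The doubling times of the cost functions: the first time `t` up to the horizon at which
the cost of completing job `j` has reached `2 ^ k`. It is `0` if there is no such time or no
job with index `j` (all genuine answers are positive, since they exceed the release time). -/
noncomputable def doublingTime (I : GSP) (j k : ℕ) : ℕ :=
  sInf {t | ∃ h : j < I.n, I.r ⟨j, h⟩ < t ∧ t ≤ I.horizon ∧ 2 ^ k ≤ I.costAt ⟨j, h⟩ t}

end GSP

/-! ### Random access machines with logarithmic cost

The memory consists of arrays of registers, each register holding a natural number. A program
is a finite piece of syntax, so it uses finitely many arrays. Every operation is charged by the
bit-lengths of all numbers involved, addresses included. Besides, a program can query an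
oracle `O : ℕ → ℕ → ℕ`; a query is charged by the bit-lengths of its arguments and answer. -/

namespace RAM

/-- `m a i` is the content of register `i` of array `a`. -/
abbrev Mem : Type := ℕ → ℕ → ℕ

/-- Write `v` into register `i` of array `a`. -/
def Mem.write (m : Mem) (a i v : ℕ) : Mem := Function.update m a (Function.update (m a) i v)

/-- Arithmetic and comparison operations. -/
inductive Op
  | add
  | sub
  | mul
  | div
  | lt
  | eq

/-- Subtraction is truncated, division rounds down (and gives `0` for the divisor `0`),
comparisons return `1` for true and `0` for false. -/
def Op.apply : Op → ℕ → ℕ → ℕ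
  | .add, x, y => x + y
  | .sub, x, y => x - y
  | .mul, x, y => x * y
  | .div, x, y => x / y
  | .lt, x, y => if x < y then 1 else 0
  | .eq, x, y => if x = y then 1 else 0

/-- Expressions: constants, reading register `i` of array `a`, and operations. -/
inductive Expr
  | const (c : ℕ)
  | read (a : ℕ) (i : Expr)
  | op (o : Op) (e₁ e₂ : Expr)

/-- The value of an expression. -/
def Expr.eval (m : Mem) : Expr → ℕ
  | .const c => c
  | .read a i => m a (i.eval m)
  | .op o e₁ e₂ => o.apply (e₁.eval m) (e₂.eval m)

/-- The cost of evaluating an expression: for every node, one plus the bit-length of its value. -/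
def Expr.cost (m : Mem) : Expr → ℕ
  | .const c => 1 + Nat.size c
  | .read a i => i.cost m + (1 + Nat.size (m a (i.eval m)))
  | .op o e₁ e₂ => e₁.cost m + e₂.cost m + (1 + Nat.size (o.apply (e₁.eval m) (e₂.eval m)))

/-- Programs. `write a i e` puts the value of `e` into register `i` of array `a`;
`query a i e₁ e₂` puts there the oracle's answer to the values of `e₁` and `e₂`. Conditions
count as true if they are non-zero. -/
inductive Prog
  | skip
  | write (a : ℕ) (i e : Expr)
  | query (a : ℕ) (i e₁ e₂ : Expr)
  | seq (c₁ c₂ : Prog)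
  | ite (b : Expr) (c₁ c₂ : Prog)
  | loop (b : Expr) (c : Prog)

/-- `Exec O c m m' t`: with oracle `O`, program `c` started on memory `m` halts with memory `m'`
after running for time `t`. -/
inductive Exec (O : ℕ → ℕ → ℕ) : Prog → Mem → Mem → ℕ → Prop
  | skip (m : Mem) : Exec O .skip m m 1
  | write (m : Mem) (a : ℕ) (i e : Expr) :
      Exec O (.write a i e) m (m.write a (i.eval m) (e.eval m)) (1 + i.cost m + e.cost m)
  | query (m : Mem) (a : ℕ) (i e₁ e₂ : Expr) :
      Exec O (.query a i e₁ e₂) m (m.write a (i.eval m) (O (e₁.eval m) (e₂.eval m)))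
        (1 + i.cost m + e₁.cost m + e₂.cost m + Nat.size (O (e₁.eval m) (e₂.eval m)))
  | seq {c₁ c₂ : Prog} {m₁ m₂ m₃ : Mem} {t₁ t₂ : ℕ} :
      Exec O c₁ m₁ m₂ t₁ → Exec O c₂ m₂ m₃ t₂ → Exec O (.seq c₁ c₂) m₁ m₃ (1 + t₁ + t₂)
  | ite_true {b : Expr} {c₁ c₂ : Prog} {m m' : Mem} {t : ℕ} :
      b.eval m ≠ 0 → Exec O c₁ m m' t → Exec O (.ite b c₁ c₂) m m' (1 + b.cost m + t)
  | ite_false {b : Expr} {c₁ c₂ : Prog} {m m' : Mem} {t : ℕ} :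
      b.eval m = 0 → Exec O c₂ m m' t → Exec O (.ite b c₁ c₂) m m' (1 + b.cost m + t)
  | loop_true {b : Expr} {c : Prog} {m₁ m₂ m₃ : Mem} {t₁ t₂ : ℕ} :
      b.eval m₁ ≠ 0 → Exec O c m₁ m₂ t₁ → Exec O (.loop b c) m₂ m₃ t₂ →
        Exec O (.loop b c) m₁ m₃ (1 + b.cost m₁ + t₁ + t₂)
  | loop_false {b : Expr} {c : Prog} {m : Mem} :
      b.eval m = 0 → Exec O (.loop b c) m m (1 + b.cost m)

end RAM

/-! ### Algorithms for the general scheduling problem -/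

namespace GSP

/-- The initial memory: `n` in register `0` of array `0`, the release times in array `1`, the
sizes in array `2`; all other registers are `0`. The weights are accessible only through the
oracle `doublingTime`. -/
def inputMem (I : GSP) : RAM.Mem := fun a i =>
  if a = 0 then (if i = 0 then I.n else 0)
  else if a = 1 then (if h : i < I.n then I.r ⟨i, h⟩ else 0)
  else if a = 2 then (if h : i < I.n then I.p ⟨i, h⟩ else 0)
  else 0

/-- The memory `m` describes the schedule `σ` as a list of blocks: register `0` of array `3` holds
the number of blocks, and the `i`-th block says that job `m 4 i` is processed from time `m 5 i` to
time `m 6 i`, i.e. in the slots `s` with `m 5 i < s ≤ m 6 i`. -/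
def Describes (I : GSP) (m : RAM.Mem) (σ : I.Schedule) : Prop :=
  ∀ s j : ℕ, (∃ h : j < I.n, σ s = some ⟨j, h⟩) ↔
    ∃ i < m 3 0, m 4 i = j ∧ m 5 i < s ∧ s ≤ m 6 i

/-- The program `c` is a polynomial-time `α`-approximation algorithm on the instances in `C`:
on each of them it halts in time polynomial in the number of jobs and the bit-lengths of the
maximum release time, size and weight, and outputs a feasible schedule whose cost is at most `α`
times that of any feasible schedule. -/
def IsPolyTimeApprox (C : Set GSP) (α : ℕ) (c : RAM.Prog) : Prop :=
  ∃ q : Polynomial ℕ, ∀ I ∈ C, ∃ (m : RAM.Mem) (t : ℕ) (σ : I.Schedule),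
    RAM.Exec I.doublingTime c I.inputMem m t ∧
    t ≤ q.eval (I.n + Nat.size I.maxRelease + Nat.size I.maxSize + Nat.size I.maxWeight) ∧
    I.Describes m σ ∧ I.Feasible σ ∧ ∀ σ' : I.Schedule, I.Feasible σ' → I.cost σ ≤ α * I.cost σ'

end GSP

/-! ### A weakest-precondition calculus with automatic time bounds -/

/-! Rounding costs to powers of two reduces scheduling to choosing a due date for each job. The
level `k` due date is the last time up to the horizon at which completing the job costs less than `2
^ k`. Its cost is taken as `levelCost k`, correct up to a factor 2. With a common release time, a
choice of due dates can be met iff, for every offered due date `e`, the jobs due after `e` have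
total size at least `H - e`. One direction is a volume bound (`exists_assignment`), the other is
processing in due date order (`startTime_add_le_dueDate`).

This covering problem is solved within a factor 4 by local ratio. Let `D` be the largest deficit of
the current choice, attained at time `e`. Charge `α * min p D` to every due date that would move a
job from at most `e` to beyond `e`, with `α` the smallest rounded-down ratio. Every feasible choice
pays at least `α * D` of this charge (`le_sum_min`, a knapsack cover inequality). A choice in which
no postponement can be taken back pays at most `4 * α * D` (`sum_min_le`). The due date attaining
`α` is now almost free and is adopted. Once no deficit is left, the steps are revisited in reverse
and undone where feasibility permits. This yields the required minimality with respect to every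
earlier stage (`good_prune`).

Integer division leaves a residual of less than `p j` on an adopted due date. Scaling the costs by
one more than the total size makes the accumulated error smaller than one unit, so the factor 4 is
exact and the schedule costs at most 8 times the optimum.

For the running time, `timePoly` bounds a program's cost in terms of a single number `X` that limits
both register lengths and loop iterations. It therefore suffices to verify the program with an `X`
polynomial in the input size (`bounds_inputSize`). -/

namespace RAM

open Polynomial

/-- All registers hold numbers of at most `X` bits. -/
def Bounded (X : ℕ) (m : Mem) : Prop := ∀ a i, m a i < 2 ^ X

/-- A bound for the bit-length of the value of an expression, as a polynomial in the bit-length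
of the registers. -/
noncomputable def Expr.bitPoly : Expr → ℕ[X]
  | .const c => C (Nat.size c)
  | .read _ _ => X
  | .op _ e₁ e₂ => e₁.bitPoly + e₂.bitPoly + 1

/-- A bound for the cost of evaluating an expression. -/
noncomputable def Expr.costPoly : Expr → ℕ[X]
  | .const c => C (1 + Nat.size c)
  | .read _ i => i.costPoly + (1 + X)
  | .op _ e₁ e₂ => e₁.costPoly + e₂.costPoly + (1 + (e₁.bitPoly + e₂.bitPoly + 1))

/-- A bound for the running time of a program, provided that all registers hold at most `X` bits
and that no loop is iterated more than `X` times. -/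
noncomputable def Prog.timePoly : Prog → ℕ[X]
  | .skip => 1
  | .write _ i e => 1 + i.costPoly + e.costPoly
  | .query _ i e₁ e₂ => 1 + i.costPoly + e₁.costPoly + e₂.costPoly + X
  | .seq c₁ c₂ => 1 + c₁.timePoly + c₂.timePoly
  | .ite b c₁ c₂ => 1 + b.costPoly + (c₁.timePoly + c₂.timePoly)
  | .loop b c => (X + 1) * (1 + b.costPoly + c.timePoly)

/-- Whether array `a` occurs as a target of the program. -/
def Prog.mods : Prog → ℕ → Bool
  | .skip, _ => false
  | .write b _ _, a => a == b
  | .query b _ _ _, a => a == b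
  | .seq c₁ c₂, a => c₁.mods a || c₂.mods a
  | .ite _ c₁ c₂, a => c₁.mods a || c₂.mods a
  | .loop _ c, a => c.mods a

/-- Products need `a + b` bits and sums one bit more than the longer operand. One crude bound for
all operations lets `bitPoly` ignore which operation occurs. -/
theorem Op.apply_lt (o : Op) {x y a b : ℕ} (hx : x < 2 ^ a) (hy : y < 2 ^ b) :
    o.apply x y < 2 ^ (a + b + 1) := by
  have h1 : 2 ^ a ≤ 2 ^ (a + b) := Nat.pow_le_pow_right (by norm_num) (by omega)
  have h2 : 2 ^ b ≤ 2 ^ (a + b) := Nat.pow_le_pow_right (by norm_num) (by omega)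
  have h3 : 2 ^ (a + b + 1) = 2 * 2 ^ (a + b) := by ring
  have h4 : 1 ≤ 2 ^ (a + b) := Nat.one_le_two_pow
  cases o
  · simp only [Op.apply]; omega
  · simp only [Op.apply]; omega
  · have : x * y < 2 ^ a * 2 ^ b := Nat.mul_lt_mul'' hx hy
    rw [← pow_add] at this
    simp only [Op.apply]; omega
  · have := Nat.div_le_self x y
    simp only [Op.apply]; omega
  · simp only [Op.apply]; split_ifs <;> omega
  · simp only [Op.apply]; split_ifs <;> omega

theorem Expr.eval_lt_bitPoly {X : ℕ} {m : Mem} (hm : Bounded X m) (e : Expr) :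
    e.eval m < 2 ^ (e.bitPoly.eval X) := by
  induction e with
  | const c => simpa [Expr.eval, Expr.bitPoly] using Nat.lt_size_self c
  | read a i => simpa [Expr.eval, Expr.bitPoly] using hm a _
  | op o e₁ e₂ h₁ h₂ => simpa [Expr.eval, Expr.bitPoly] using o.apply_lt h₁ h₂

theorem Expr.cost_le_costPoly {X : ℕ} {m : Mem} (hm : Bounded X m) (e : Expr) :
    e.cost m ≤ e.costPoly.eval X := by
  induction e with
  | const c => simp [Expr.cost, Expr.costPoly]
  | read a i h =>
    have := Nat.size_le.2 (hm a (i.eval m))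
    simp only [Expr.cost, Expr.costPoly, eval_add, eval_X, eval_one]
    omega
  | op o e₁ e₂ h₁ h₂ =>
    have := Nat.size_le.2 ((Expr.op o e₁ e₂).eval_lt_bitPoly hm)
    simp only [Expr.eval, Expr.bitPoly, eval_add, eval_one] at this
    simp only [Expr.cost, Expr.costPoly, eval_add, eval_one]
    omega

/-- Specifications need only mention what changes. As `mods` is a computable syntactic test, its
side conditions are usually closed by `rfl`. -/
theorem Exec.frame {O : ℕ → ℕ → ℕ} {c : Prog} {m m' : Mem} {t : ℕ} (h : Exec O c m m' t) (a : ℕ)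
    (ha : c.mods a = false) : m' a = m a := by
  induction h with
  | skip => rfl
  | write m b i e => simp_all [Prog.mods, Mem.write]
  | query m b i e₁ e₂ => simp_all [Prog.mods, Mem.write]
  | seq _ _ h₁ h₂ =>
    simp only [Prog.mods, Bool.or_eq_false_iff] at ha
    rw [h₂ ha.2, h₁ ha.1]
  | ite_true _ _ h =>
    simp only [Prog.mods, Bool.or_eq_false_iff] at ha
    exact h ha.1
  | ite_false _ _ h =>
    simp only [Prog.mods, Bool.or_eq_false_iff] at ha
    exact h ha.2
  | loop_true _ _ _ h₁ h₂ => rw [h₂ ha, h₁ ha]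
  | loop_false => rfl

/-- Started on `m`, the program `c` halts within the time `c.timePoly`, keeps the registers
bounded, and reaches a memory satisfying `Q`. -/
def WP (X : ℕ) (O : ℕ → ℕ → ℕ) (c : Prog) (Q : Mem → Prop) (m : Mem) : Prop :=
  Bounded X m → ∃ m' t, Exec O c m m' t ∧ t ≤ c.timePoly.eval X ∧ Bounded X m' ∧ Q m'

@[simp] theorem Mem.write_same (m : Mem) (a i v : ℕ) :
    m.write a i v a = Function.update (m a) i v := by simp [Mem.write]

@[simp] theorem Mem.write_of_ne (m : Mem) {a b : ℕ} (i v : ℕ) (h : b ≠ a) :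
    m.write a i v b = m b := by simp [Mem.write, h]

theorem Bounded.write {X : ℕ} {m : Mem} (hm : Bounded X m) {a i v : ℕ} (hv : v < 2 ^ X) :
    Bounded X (m.write a i v) := by
  intro b k
  by_cases hb : b = a
  · subst hb
    by_cases hk : k = i
    · subst hk; simpa using hv
    · simpa [hk] using hm b k
  · simpa [hb] using hm b k

/-! ### Proof rules for total correctness with time bounds. -/

section rules

variable {X : ℕ} {O : ℕ → ℕ → ℕ} {Q : Mem → Prop} {m : Mem}

theorem WP.mono {c : Prog} {Q' : Mem → Prop} (h : WP X O c Q m)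
    (hQ : ∀ m', Bounded X m' → (∀ a, c.mods a = false → m' a = m a) → Q m' → Q' m') :
    WP X O c Q' m := fun hm => by
  obtain ⟨m', t, he, ht, hb, hq⟩ := h hm
  exact ⟨m', t, he, ht, hb, hQ _ hb he.frame hq⟩

theorem WP.of_bounded {c : Prog} (h : Bounded X m → WP X O c Q m) : WP X O c Q m :=
  fun hm => h hm hm

theorem wp_skip (h : Q m) : WP X O .skip Q m := fun hm =>
  ⟨m, 1, .skip m, by simp [Prog.timePoly], hm, h⟩

theorem wp_write {a : ℕ} {i e : Expr} (hv : e.eval m < 2 ^ X)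
    (h : Q (m.write a (i.eval m) (e.eval m))) : WP X O (.write a i e) Q m := fun hm => by
  refine ⟨_, _, .write m a i e, ?_, hm.write hv, h⟩
  simp only [Prog.timePoly, eval_add, eval_one]
  have := i.cost_le_costPoly hm
  have := e.cost_le_costPoly hm
  omega

theorem wp_query {a : ℕ} {i e₁ e₂ : Expr} (hv : O (e₁.eval m) (e₂.eval m) < 2 ^ X)
    (h : Q (m.write a (i.eval m) (O (e₁.eval m) (e₂.eval m)))) :
    WP X O (.query a i e₁ e₂) Q m := fun hm => by
  refine ⟨_, _, .query m a i e₁ e₂, ?_, hm.write hv, h⟩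
  simp only [Prog.timePoly, eval_add, eval_one, eval_X]
  have := i.cost_le_costPoly hm
  have := e₁.cost_le_costPoly hm
  have := e₂.cost_le_costPoly hm
  have := Nat.size_le.2 hv
  omega

theorem wp_seq {c₁ c₂ : Prog} (h : WP X O c₁ (fun m' => WP X O c₂ Q m') m) :
    WP X O (.seq c₁ c₂) Q m := fun hm => by
  obtain ⟨m₁, t₁, he₁, ht₁, hb₁, h₂⟩ := h hm
  obtain ⟨m₂, t₂, he₂, ht₂, hb₂, hq⟩ := h₂ hb₁
  refine ⟨m₂, _, .seq he₁ he₂, ?_, hb₂, hq⟩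
  simp only [Prog.timePoly, eval_add, eval_one]
  omega

theorem wp_ite {b : Expr} {c₁ c₂ : Prog} (h₁ : b.eval m ≠ 0 → WP X O c₁ Q m)
    (h₂ : b.eval m = 0 → WP X O c₂ Q m) : WP X O (.ite b c₁ c₂) Q m := fun hm => by
  have hc := b.cost_le_costPoly hm
  by_cases hb : b.eval m = 0
  · obtain ⟨m', t, he, ht, hb', hq⟩ := h₂ hb hm
    refine ⟨m', _, .ite_false hb he, ?_, hb', hq⟩
    simp only [Prog.timePoly, eval_add, eval_one]
    omega
  · obtain ⟨m', t, he, ht, hb', hq⟩ := h₁ hb hm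
    refine ⟨m', _, .ite_true hb he, ?_, hb', hq⟩
    simp only [Prog.timePoly, eval_add, eval_one]
    omega

/-- Total correctness of loops, with a loop invariant and a variant that bounds the number of
iterations. -/
theorem wp_loop {b : Expr} {c : Prog} (Inv : Mem → Prop) (μ : Mem → ℕ)
    (h₀ : Inv m) (hμ : μ m ≤ X)
    (step : ∀ m', Inv m' → b.eval m' ≠ 0 → (∀ a, c.mods a = false → m' a = m a) →
      WP X O c (fun m'' => Inv m'' ∧ μ m'' < μ m') m')
    (done : ∀ m', Inv m' → b.eval m' = 0 → (∀ a, c.mods a = false → m' a = m a) → Q m') :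
    WP X O (.loop b c) Q m := by
  -- The bound `k` on the variant also prices the loop: `k + 1` charges for test and body cover at
  -- most `k` iterations and the final failing test.
  have key : ∀ k m₁, μ m₁ ≤ k → Inv m₁ → Bounded X m₁ →
      (∀ a, c.mods a = false → m₁ a = m a) → ∃ m' t, Exec O (.loop b c) m₁ m' t ∧
      t ≤ (k + 1) * (1 + b.costPoly.eval X + c.timePoly.eval X) ∧ Bounded X m' ∧ Q m' := by
    intro k
    induction k with
    | zero =>
      intro m₁ hk hi hm hf
      have hc := b.cost_le_costPoly hm
      by_cases hb : b.eval m₁ = 0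
      · exact ⟨m₁, _, .loop_false hb, by omega, hm, done _ hi hb hf⟩
      · obtain ⟨m₂, t, he, ht, hb', _, h⟩ := step _ hi hb hf hm
        omega
    | succ k ih =>
      intro m₁ hk hi hm hf
      have hc := b.cost_le_costPoly hm
      by_cases hb : b.eval m₁ = 0
      · refine ⟨m₁, _, .loop_false hb, ?_, hm, done _ hi hb hf⟩
        nlinarith
      · obtain ⟨m₂, t, he, ht, hb', hi', h⟩ := step _ hi hb hf hm
        obtain ⟨m₃, t', he', ht', hb'', hq⟩ := ih m₂ (by omega) hi' hb'
          (fun a ha => (he.frame a ha).trans (hf a ha))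
        refine ⟨m₃, _, .loop_true hb he he', ?_, hb'', hq⟩
        rw [add_mul _ 1, one_mul]
        omega
  intro hm
  obtain ⟨m', t, he, ht, hb, hq⟩ := key _ m le_rfl h₀ hm (fun _ _ => rfl)
  refine ⟨m', t, he, ht.trans ?_, hb, hq⟩
  simp only [Prog.timePoly, eval_add, eval_one, eval_X, eval_mul]
  gcongr

end rules

/-- `for i < N do c`, where the counter `i` is register `0` of array `i` and the bound `N` is
register `0` of array `N`. -/
def Prog.forLoop (i N : ℕ) (c : Prog) : Prog :=
  .seq (.write i (.const 0) (.const 0))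
    (.loop (.op .lt (.read i (.const 0)) (.read N (.const 0)))
      (.seq c (.write i (.const 0) (.op .add (.read i (.const 0)) (.const 1)))))

/-- The rule for counting loops. The body must change neither the counter nor the bound. -/
theorem wp_for {X : ℕ} {O : ℕ → ℕ → ℕ} {Q : Mem → Prop} {m : Mem} {i N : ℕ} {c : Prog}
    (Inv : ℕ → Mem → Prop) (hi : c.mods i = false) (hN : c.mods N = false) (hiN : N ≠ i)
    (hX : m N 0 ≤ X)
    (h₀ : Inv 0 (m.write i 0 0))
    (step : ∀ k m', k < m N 0 → Inv k m' → m' i 0 = k → Bounded X m' →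
      (∀ a, a ≠ i → c.mods a = false → m' a = m a) →
      WP X O c (fun m'' => Inv (k + 1) (m''.write i 0 (k + 1))) m')
    (done : ∀ m', Inv (m N 0) m' → (∀ a, a ≠ i → c.mods a = false → m' a = m a) → Q m') :
    WP X O (.forLoop i N c) Q m := by
  apply wp_seq
  apply wp_write (by simp [Expr.eval])
  simp only [Expr.eval]
  have hmod : ∀ a, a ≠ i → c.mods a = false →
      (Prog.seq c (.write i (.const 0) (.op .add (.read i (.const 0)) (.const 1)))).mods a
        = false := by
    intro a ha hc
    simp [Prog.mods, hc, ha]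
  apply wp_loop (fun m' => m' i 0 ≤ m N 0 ∧ Inv (m' i 0) m' ∧
      ∀ a, a ≠ i → c.mods a = false → m' a = m a)
    (fun m' => m N 0 - m' i 0)
  · refine ⟨by simp, by simpa using h₀, fun a ha _ => by simp [ha]⟩
  · simp only [Mem.write_same, Function.update_self]; omega
  · rintro m' ⟨hle, hinv, hfr⟩ hb -
    have hlt : m' i 0 < m N 0 := by
      simp only [Expr.eval, Op.apply, hfr N hiN hN] at hb
      by_contra hlt
      simp [hlt] at hb
    apply wp_seq
    apply WP.of_bounded
    intro hbd
    refine (step _ m' hlt hinv rfl hbd hfr).mono ?_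
    intro m'' hbd'' hf hI
    have hii := hf i hi
    have hv : (Expr.op .add (.read i (.const 0)) (.const 1)).eval m'' = m' i 0 + 1 := by
      simp [Expr.eval, Op.apply, hii]
    have hlt2 : m' i 0 + 1 < 2 ^ X := lt_of_le_of_lt (by omega) (Nat.lt_two_pow_self (n := X))
    apply wp_write (by rw [hv]; exact hlt2)
    rw [hv]
    refine ⟨⟨?_, ?_, ?_⟩, ?_⟩
    · simp [Expr.eval]; omega
    · simpa [Expr.eval] using hI
    · intro a ha hc
      simp [ha, hf a hc, hfr a ha hc]
    · simp [Expr.eval]; omega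
  · rintro m' ⟨hle, hinv, hfr⟩ hb -
    have : m' i 0 = m N 0 := by
      simp only [Expr.eval, Op.apply, hfr N hiN hN] at hb
      by_contra hne
      simp [show m' i 0 < m N 0 by omega] at hb
    rw [this] at hinv
    exact done m' hinv hfr

end RAM

/-! ### A local-ratio algorithm for choosing due dates -/

/-- A due date problem: `n` jobs of sizes `p j`; job `j` may choose one of the `L` due dates
`E q` with `q / L = j`. All jobs are available from time `r`. -/
structure DueDates where
  n : ℕ
  L : ℕ
  r : ℕ
  p : ℕ → ℕ
  E : ℕ → ℕ
  p_pos : ∀ j < n, 0 < p j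
  L_pos : 0 < L
  le_E : ∀ q < n * L, r ≤ E q
  E_top : ∀ j < n, E (j * L + (L - 1)) = r + ∑ j ∈ Finset.range n, p j

namespace DueDates

variable (I : DueDates)

/-- The time at which all jobs can be finished. -/
def H : ℕ := I.r + ∑ j ∈ Finset.range I.n, I.p j

/-- The total size of the jobs with a due date later than `e` under the assignment `ρ`. -/
def cov (ρ : ℕ → ℕ) (e : ℕ) : ℕ := ∑ j ∈ Finset.range I.n, if e < I.E (ρ j) then I.p j else 0

/-- The size still missing after the time `E q`. -/
def deficit (ρ : ℕ → ℕ) (q : ℕ) : ℕ := I.H - I.E q - I.cov ρ (I.E q)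

/-- Each job chooses one of its own due dates. -/
def Fits (ρ : ℕ → ℕ) : Prop := ∀ j < I.n, ρ j / I.L = j

/-- The due dates can be met by a schedule. -/
def Feas (ρ : ℕ → ℕ) : Prop := ∀ q < I.n * I.L, I.deficit ρ q = 0

/-- Job `j` cannot return from the due date `E (ρ j)` to one that is at most `d`. -/
def Critical (ρ : ℕ → ℕ) (d j : ℕ) : Prop :=
  ∃ q < I.n * I.L, d ≤ I.E q ∧ I.E q < I.E (ρ j) ∧ I.cov ρ (I.E q) - I.p j < I.H - I.E q

/-- `ρ` is a good completion of the partial assignment `cur` for the residual costs `G`. -/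
structure Good (cur G ρ : ℕ → ℕ) : Prop where
  fits : I.Fits ρ
  feas : I.Feas ρ
  le : ∀ j < I.n, I.E (cur j) ≤ I.E (ρ j)
  critical : ∀ j < I.n, I.E (cur j) < I.E (ρ j) → I.Critical ρ (I.E (cur j)) j
  cost : ∀ o, I.Fits o → I.Feas o →
    ∑ j ∈ Finset.range I.n, (G (ρ j) - I.p j) ≤ 4 * ∑ j ∈ Finset.range I.n, G (o j)

/-- The due date `E q` postpones its job beyond `e`. -/
def Eligible (cur : ℕ → ℕ) (e q : ℕ) : Prop := I.E (cur (q / I.L)) ≤ e ∧ e < I.E q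

instance (cur : ℕ → ℕ) (e q : ℕ) : Decidable (I.Eligible cur e q) :=
  inferInstanceAs (Decidable (_ ∧ _))

/-- One step of the algorithm: for the largest deficit `D`, attained at time `e`, the residual
costs are lowered in proportion to the truncated sizes, and the job of the due date `q₁`, which
has almost no residual cost left, is assigned that due date. -/
structure Step (cur G : ℕ → ℕ) (D e α q₁ : ℕ) (G' : ℕ → ℕ) : Prop where
  pos : 0 < D
  attained : ∃ q < I.n * I.L, e = I.E q ∧ I.deficit cur q = D
  max : ∀ q < I.n * I.L, I.deficit cur q ≤ D
  lt : q₁ < I.n * I.L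
  eligible : I.Eligible cur e q₁
  ratio : α = G q₁ / min (I.p (q₁ / I.L)) D
  min : ∀ q < I.n * I.L, I.Eligible cur e q → α ≤ G q / min (I.p (q / I.L)) D
  residual : ∀ q < I.n * I.L, G' q =
    if I.Eligible cur e q then G q - α * Min.min (I.p (q / I.L)) D else G q

/-- Reassign job `k` if the result is feasible. -/
noncomputable def prune (ρ : ℕ → ℕ) (k v : ℕ) : ℕ → ℕ :=
  open Classical in if I.Feas (Function.update ρ k v) then Function.update ρ k v else ρ

variable {I}

theorem Fits.lt {ρ : ℕ → ℕ} (h : I.Fits ρ) {j : ℕ} (hj : j < I.n) : ρ j < I.n * I.L := by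
  have := h j hj
  rw [← Nat.div_lt_iff_lt_mul I.L_pos, this]
  exact hj

theorem Fits.update {ρ : ℕ → ℕ} (h : I.Fits ρ) {q : ℕ} :
    I.Fits (Function.update ρ (q / I.L) q) := by
  intro j hj
  by_cases hk : j = q / I.L
  · subst hk; simp
  · simp [hk, h j hj]

theorem cov_mono {ρ ρ' : ℕ → ℕ} (h : ∀ j < I.n, I.E (ρ j) ≤ I.E (ρ' j)) (e : ℕ) :
    I.cov ρ e ≤ I.cov ρ' e := by
  apply Finset.sum_le_sum
  intro j hj
  have := h j (Finset.mem_range.1 hj)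
  split_ifs <;> omega

/-- The main estimate: the truncated sizes of the jobs postponed beyond `e` add up to at most
four times the largest deficit. -/
theorem sum_min_le {cur ρ : ℕ → ℕ} {D e : ℕ} (hmax : ∀ q < I.n * I.L, I.deficit cur q ≤ D)
    (hle : ∀ j < I.n, I.E (cur j) ≤ I.E (ρ j))
    (hcrit : ∀ j < I.n, I.E (cur j) < I.E (ρ j) → I.Critical ρ (I.E (cur j)) j) :
    (∑ j ∈ Finset.range I.n,
      if I.E (cur j) ≤ e ∧ e < I.E (ρ j) then min (I.p j) D else 0) ≤ 4 * D := by
  classical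
  rw [← Finset.sum_filter]
  set F := (Finset.range I.n).filter fun j => I.E (cur j) ≤ e ∧ e < I.E (ρ j) with hF
  have hFm : ∀ j ∈ F, j < I.n ∧ I.E (cur j) ≤ e ∧ e < I.E (ρ j) := fun j hj => by
    simpa [hF] using hj
  -- The time `E (w j)` witnesses that `j` cannot return: without `j`, the cover of `ρ` there is too
  -- small.
  choose! w hw hwl hwr hwc using fun j (hj : j ∈ F) =>
    hcrit j (hFm j hj).1 ((hFm j hj).2.1.trans_lt (hFm j hj).2.2)
  -- At a witness of `j` straddled by all jobs of `A`, `ρ` counts all of `A` and `cur` none of it.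
  -- Criticality of `j` then makes the rest of `A` smaller than the deficit of `cur` there, hence at
  -- most `D`. Truncation bounds the share of `j` by another `D`.
  have key : ∀ A ⊆ F, ∀ j ∈ A,
      (∀ l ∈ A, I.E (cur l) ≤ I.E (w j) ∧ I.E (w j) < I.E (ρ l)) →
      ∑ l ∈ A, min (I.p l) D ≤ 2 * D := by
    intro A hA j hj hl
    have hD := hmax _ (hw j (hA hj))
    have hc := hwc j (hA hj)
    have h1 : I.cov cur (I.E (w j)) + ∑ l ∈ A, I.p l ≤ I.cov ρ (I.E (w j)) := by
      have : ∑ l ∈ A, I.p l = ∑ l ∈ Finset.range I.n, if l ∈ A then I.p l else 0 := by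
        rw [← Finset.sum_filter]
        congr 1
        ext l
        simp only [Finset.mem_filter, Finset.mem_range]
        exact ⟨fun h => ⟨(hFm l (hA h)).1, h⟩, fun h => h.2⟩
      rw [this, cov, cov, ← Finset.sum_add_distrib]
      apply Finset.sum_le_sum
      intro l hln
      have h3 := hle l (Finset.mem_range.1 hln)
      by_cases hlA : l ∈ A
      · have := hl l hlA
        simp only [hlA, if_true]
        rw [if_neg (by omega), if_pos (by omega)]
        omega
      · simp only [hlA, if_false]
        split_ifs <;> omega
    have h2 : ∑ l ∈ A.erase j, min (I.p l) D ≤ ∑ l ∈ A.erase j, I.p l :=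
      Finset.sum_le_sum fun l _ => min_le_left _ _
    rw [← Finset.add_sum_erase _ _ hj] at h1 ⊢
    have h3 := min_le_right (I.p j) D
    unfold deficit at hD
    omega
  rw [← Finset.sum_filter_add_sum_filter_not F fun j => e ≤ I.E (w j)]
  -- The earliest witness not before `e` is straddled by the whole class: current due dates are at
  -- most `e`, and each `E (ρ l)` exceeds the witness of `l`.
  have hA : ∑ l ∈ F.filter (fun j => e ≤ I.E (w j)), min (I.p l) D ≤ 2 * D := by
    rcases (F.filter fun j => e ≤ I.E (w j)).eq_empty_or_nonempty with h | h
    · simp [h]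
    · obtain ⟨j, hj, hmin⟩ := Finset.exists_min_image _ (fun j => I.E (w j)) h
      refine key _ (Finset.filter_subset _ _) j hj fun l hl => ?_
      have h1 := hmin l hl
      rw [Finset.mem_filter] at hl hj
      have h2 := hwr l hl.1
      have h3 := hFm l hl.1
      omega
  -- Symmetrically, the latest witness before `e` is straddled, since every `E (ρ l)` exceeds `e`.
  have hB : ∑ l ∈ F.filter (fun j => ¬ e ≤ I.E (w j)), min (I.p l) D ≤ 2 * D := by
    rcases (F.filter fun j => ¬ e ≤ I.E (w j)).eq_empty_or_nonempty with h | h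
    · rw [h]; simp
    · obtain ⟨j, hj, hmax⟩ := Finset.exists_max_image _ (fun j => I.E (w j)) h
      refine key _ (Finset.filter_subset _ _) j hj fun l hl => ?_
      have h1 := hmax l hl
      rw [Finset.mem_filter] at hl hj
      have h2 := hwl l hl.1
      have h3 := hFm l hl.1
      omega
  omega

/-- Every feasible assignment postpones a total truncated size of at least the deficit. -/
theorem le_sum_min {cur o : ℕ → ℕ} {q : ℕ} (hq : q < I.n * I.L) (ho : I.Feas o) :
    I.deficit cur q ≤ ∑ j ∈ Finset.range I.n,
      if I.E (cur j) ≤ I.E q ∧ I.E q < I.E (o j) then min (I.p j) (I.deficit cur q) else 0 := by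
  classical
  set D := I.deficit cur q with hD
  rw [← Finset.sum_filter]
  set F := (Finset.range I.n).filter fun j => I.E (cur j) ≤ I.E q ∧ I.E q < I.E (o j)
  -- One job of size at least `D` pays `D` by itself. Otherwise truncation has no effect, and the
  -- postponed jobs must supply the missing cover.
  by_cases h : ∃ j ∈ F, D ≤ I.p j
  · obtain ⟨j, hj, hp⟩ := h
    calc D = min (I.p j) D := by omega
      _ ≤ _ := Finset.single_le_sum (f := fun j => min (I.p j) D) (fun _ _ => Nat.zero_le _) hj
  · push Not at h
    have h0 : ∑ j ∈ F, min (I.p j) D = ∑ j ∈ F, I.p j :=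
      Finset.sum_congr rfl fun j hj => min_eq_left (h j hj).le
    rw [h0]
    have h1 := ho q hq
    have h2 : I.cov o (I.E q) ≤ I.cov cur (I.E q) + ∑ j ∈ F, I.p j := by
      rw [Finset.sum_filter, cov, cov, ← Finset.sum_add_distrib]
      apply Finset.sum_le_sum
      intro j _
      split_ifs <;> omega
    unfold deficit at h1 hD
    omega

/-- If all jobs were due after `E q`, the cover would be the total size and leave no deficit. A job
due by then is eligible through its last due date, which is `H` and exceeds `E q` because the
deficit is positive. -/
theorem exists_eligible {cur : ℕ → ℕ} {q : ℕ} (hq : q < I.n * I.L)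
    (h : 0 < I.deficit cur q) : ∃ q₁ < I.n * I.L, I.Eligible cur (I.E q) q₁ := by
  have hj : ∃ j < I.n, I.E (cur j) ≤ I.E q := by
    by_contra! hj
    have : I.cov cur (I.E q) = ∑ j ∈ Finset.range I.n, I.p j :=
      Finset.sum_congr rfl fun j hjn => if_pos (hj j (Finset.mem_range.1 hjn))
    have h1 := I.le_E q hq
    rw [deficit, this, H] at h
    omega
  obtain ⟨j, hj, hle⟩ := hj
  have hL := I.L_pos
  have hdiv : (j * I.L + (I.L - 1)) / I.L = j := by
    rw [mul_comm, Nat.mul_add_div hL, Nat.div_eq_of_lt (by omega), add_zero]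
  refine ⟨j * I.L + (I.L - 1), ?_, ?_, ?_⟩
  · rw [← Nat.div_lt_iff_lt_mul hL, hdiv]; exact hj
  · rw [hdiv]; exact hle
  · rw [I.E_top j hj]
    unfold deficit H at h
    omega

/-! ### Analysis of one local-ratio step. -/

namespace Step

variable {cur G G' : ℕ → ℕ} {D e α q₁ : ℕ}

theorem job_lt (h : I.Step cur G D e α q₁ G') : q₁ / I.L < I.n := by
  rw [Nat.div_lt_iff_lt_mul I.L_pos]; exact h.lt

theorem le_update (h : I.Step cur G D e α q₁ G') (j : ℕ) :
    I.E (cur j) ≤ I.E (Function.update cur (q₁ / I.L) q₁ j) := by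
  by_cases hj : j = q₁ / I.L
  · subst hj
    have := h.eligible
    unfold Eligible at this
    simp only [Function.update_self]
    omega
  · simp [hj]

theorem mul_le (h : I.Step cur G D e α q₁ G') {q : ℕ} (hq : q < I.n * I.L)
    (hel : I.Eligible cur e q) : α * Min.min (I.p (q / I.L)) D ≤ G q :=
  (Nat.mul_le_mul_right _ (h.min q hq hel)).trans (Nat.div_mul_le_self _ _)

theorem residual_le (h : I.Step cur G D e α q₁ G') {q : ℕ} (hq : q < I.n * I.L) : G' q ≤ G q := by
  rw [h.residual q hq]; split_ifs <;> omega

/-- The residual costs of the chosen due dates stay at most the sizes. -/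
theorem residual_update_le (h : I.Step cur G D e α q₁ G') (hf : I.Fits cur)
    (hG : ∀ j < I.n, G (cur j) ≤ I.p j) (j : ℕ) (hj : j < I.n) :
    G' (Function.update cur (q₁ / I.L) q₁ j) ≤ I.p j := by
  by_cases hjk : j = q₁ / I.L
  · have hp := I.p_pos j hj
    have hD := h.pos
    rw [hjk, Function.update_self, h.residual _ h.lt, if_pos h.eligible, h.ratio, ← hjk]
    -- As `α` is the rounded-down quotient, the residual cost of `q₁` is the remainder, which is
    -- below `min (p j) D`.
    have h1 := Nat.mod_add_div (G q₁) (Min.min (I.p j) D)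
    have h2 := Nat.mod_lt (G q₁) (show 0 < Min.min (I.p j) D by omega)
    rw [mul_comm] at h1
    omega
  · rw [Function.update_of_ne hjk]
    exact (h.residual_le (hf.lt hj)).trans (hG j hj)

/-- The variant of the algorithm: the number of due dates not later than the chosen ones. -/
theorem card_lt (h : I.Step cur G D e α q₁ G') :
    ((Finset.range (I.n * I.L)).filter fun q => I.E q ≤ I.E (cur (q / I.L))).card <
      ((Finset.range (I.n * I.L)).filter fun q =>
        I.E q ≤ I.E (Function.update cur (q₁ / I.L) q₁ (q / I.L))).card := by
  apply Finset.card_lt_card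
  rw [Finset.ssubset_iff_of_subset]
  · refine ⟨q₁, by simp [h.lt], ?_⟩
    have := h.eligible
    unfold Eligible at this
    simp only [Finset.mem_filter, not_and]
    omega
  · intro q hq
    rw [Finset.mem_filter] at hq ⊢
    exact ⟨hq.1, hq.2.trans (h.le_update _)⟩

/-- The inductive step of the local-ratio argument. Passing from `G'` back to `G` raises the cost of
any feasible choice by at least `α * D`, and that of the pruned choice, up to the allowance `p j`
per job, by at most four times as much. -/
theorem good_prune (h : I.Step cur G D e α q₁ G') (hf : I.Fits cur)
    (hG : ∀ j < I.n, G (cur j) ≤ I.p j) {ρ : ℕ → ℕ}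
    (hρ : I.Good (Function.update cur (q₁ / I.L) q₁) G' ρ) :
    I.Good cur G (I.prune ρ (q₁ / I.L) (cur (q₁ / I.L))) := by
  classical
  set k := q₁ / I.L with hk
  set ρ' := I.prune ρ k (cur k) with hρ'
  have hkn := h.job_lt
  have hcurle : ∀ j < I.n, I.E (cur j) ≤ I.E (ρ j) := fun j hj =>
    (h.le_update j).trans (hρ.le j hj)
  have hcases : (ρ' = Function.update ρ k (cur k) ∧ I.Feas ρ') ∨
      (ρ' = ρ ∧ ¬ I.Feas (Function.update ρ k (cur k))) := by
    rw [hρ', prune]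
    split_ifs with h1
    · exact Or.inl ⟨rfl, h1⟩
    · exact Or.inr ⟨rfl, h1⟩
  have hfits : I.Fits ρ' := by
    rcases hcases with ⟨h1, -⟩ | ⟨h1, -⟩
    · rw [h1]
      intro j hj
      by_cases hjk : j = k
      · subst hjk; simpa using hf _ hj
      · simpa [hjk] using hρ.fits j hj
    · rw [h1]; exact hρ.fits
  have hfeas : I.Feas ρ' := by
    rcases hcases with ⟨-, h1⟩ | ⟨h1, -⟩
    · exact h1
    · rw [h1]; exact hρ.feas
  have hle' : ∀ j < I.n, I.E (ρ' j) ≤ I.E (ρ j) := by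
    intro j hj
    rcases hcases with ⟨h1, -⟩ | ⟨h1, -⟩
    · rw [h1]
      by_cases hjk : j = k
      · subst hjk; simpa using hcurle _ hj
      · simp [hjk]
    · rw [h1]
  have hle : ∀ j < I.n, I.E (cur j) ≤ I.E (ρ' j) := by
    intro j hj
    rcases hcases with ⟨h1, -⟩ | ⟨h1, -⟩
    · rw [h1]
      by_cases hjk : j = k
      · subst hjk; simp
      · simpa [hjk] using hcurle j hj
    · rw [h1]; exact hcurle j hj
  have hcrit : ∀ j < I.n, I.E (cur j) < I.E (ρ' j) → I.Critical ρ' (I.E (cur j)) j := by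
    intro j hj hlt
    by_cases hjk : j = k
    · rcases hcases with ⟨h1, -⟩ | ⟨h1, h2⟩
      · rw [h1, hjk] at hlt; simp at hlt
      -- If returning `k` is infeasible, a time where it fails is the witness: the covers before and
      -- after the return differ there, so it lies between the two due dates of `k`.
      · unfold Feas at h2
        push Not at h2
        obtain ⟨q, hq, hne⟩ := h2
        have hfq := hρ.feas q hq
        rw [deficit] at hne hfq
        have hsum : I.cov ρ (I.E q) + (if I.E q < I.E (cur k) then I.p k else 0) =
            I.cov (Function.update ρ k (cur k)) (I.E q) +
              (if I.E q < I.E (ρ k) then I.p k else 0) := by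
          have hmem : k ∈ Finset.range I.n := Finset.mem_range.2 hkn
          have he : ∑ j ∈ (Finset.range I.n).erase k,
              (if I.E q < I.E (Function.update ρ k (cur k) j) then I.p j else 0) =
              ∑ j ∈ (Finset.range I.n).erase k, (if I.E q < I.E (ρ j) then I.p j else 0) := by
            refine Finset.sum_congr rfl fun j hj => ?_
            rw [Function.update_of_ne (Finset.ne_of_mem_erase hj)]
          rw [cov, cov, ← Finset.add_sum_erase _ _ hmem, ← Finset.add_sum_erase _ _ hmem, he,
            Function.update_self]
          omega
        have hck := hcurle k hkn
        refine ⟨q, hq, ?_, ?_, ?_⟩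
        · rw [hjk]; by_contra hlt'
          rw [if_pos (by omega), if_pos (by omega)] at hsum
          omega
        · rw [h1, hjk]; by_contra hlt'
          rw [if_neg (by omega), if_neg (by omega)] at hsum
          omega
        · rw [h1, hjk]
          split_ifs at hsum <;> omega
    -- For other jobs the old witness survives, because pruning `k` can only decrease the cover.
    · have hlt' := hlt.trans_le (hle' j hj)
      have hcr := hρ.critical j hj
      rw [Function.update_of_ne hjk] at hcr
      obtain ⟨q, hq, h1, h2, h3⟩ := hcr hlt'
      refine ⟨q, hq, h1, ?_, ?_⟩
      · rcases hcases with ⟨h4, -⟩ | ⟨h4, -⟩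
        · rw [h4, Function.update_of_ne hjk]; exact h2
        · rw [h4]; exact h2
      · have := cov_mono hle' (I.E q)
        omega
  refine ⟨hfits, hfeas, hle, hcrit, fun o ho hof => ?_⟩
  -- lower bound for the optimum
  obtain ⟨q₀, hq₀, rfl, hD⟩ := h.attained
  have hlow : α * D + ∑ j ∈ Finset.range I.n, G' (o j) ≤ ∑ j ∈ Finset.range I.n, G (o j) := by
    have h1 := le_sum_min (cur := cur) hq₀ hof
    rw [hD] at h1
    refine (Nat.add_le_add_right (Nat.mul_le_mul_left α h1) _).trans ?_
    rw [Finset.mul_sum, ← Finset.sum_add_distrib]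
    apply Finset.sum_le_sum
    intro j hj
    have hjn := Finset.mem_range.1 hj
    have hoj := ho.lt hjn
    have hdiv := ho j hjn
    rw [h.residual _ hoj]
    by_cases hel : I.Eligible cur (I.E q₀) (o j)
    · have := h.mul_le hoj hel
      rw [if_pos hel]
      unfold Eligible at hel
      rw [hdiv] at hel this ⊢
      rw [if_pos hel]
      omega
    · rw [if_neg hel]
      unfold Eligible at hel
      rw [hdiv] at hel
      rw [if_neg hel]
      omega
  -- upper bound for the algorithm
  have hup : ∑ j ∈ Finset.range I.n, (G (ρ' j) - I.p j) ≤
      ∑ j ∈ Finset.range I.n, (G' (ρ j) - I.p j) + α * (4 * D) := by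
    refine le_trans ?_ (Nat.add_le_add_left (Nat.mul_le_mul_left α
      (sum_min_le (e := I.E q₀) h.max hle hcrit)) _)
    rw [Finset.mul_sum, ← Finset.sum_add_distrib]
    apply Finset.sum_le_sum
    intro j hj
    have hjn := Finset.mem_range.1 hj
    -- A job at its current due date contributes nothing, since `G (cur j) ≤ p j`. Any other job has
    -- the same due date in `ρ'` and `ρ`, and only the charge separates `G` from `G'`.
    by_cases hc : ρ' j = cur j
    · have := hG j hjn
      rw [hc]; omega
    · have hρj : ρ' j = ρ j := by
        rcases hcases with ⟨h4, -⟩ | ⟨h4, -⟩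
        · rw [h4] at hc ⊢
          by_cases hjk : j = k
          · subst hjk; simp at hc
          · simp [hjk]
        · rw [h4]
      have hlt := hfits.lt hjn
      have hdiv := hfits j hjn
      rw [← hρj, h.residual _ hlt]
      by_cases hel : I.Eligible cur (I.E q₀) (ρ' j)
      · have := h.mul_le hlt hel
        rw [if_pos hel]
        unfold Eligible at hel
        rw [hdiv] at hel this ⊢
        rw [if_pos hel]
        omega
      · rw [if_neg hel]
        omega
  have := hρ.cost o ho hof
  have h4 : α * (4 * D) = 4 * (α * D) := by ring
  omega

end Step

/-- When there is no deficit, the partial assignment itself is a good completion. -/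
theorem good_self {cur G : ℕ → ℕ} (hf : I.Fits cur) (hG : ∀ j < I.n, G (cur j) ≤ I.p j)
    (h : I.Feas cur) : I.Good cur G cur where
  fits := hf
  feas := h
  le _ _ := le_rfl
  critical _ _ hlt := absurd hlt (lt_irrefl _)
  cost o _ _ := by
    rw [Finset.sum_eq_zero fun j hj => Nat.sub_eq_zero_of_le (hG j (Finset.mem_range.1 hj))]
    exact Nat.zero_le _

variable (I) in
/-- Undoing the recorded steps `i - 1, …, 0` leads from `ρ` to an assignment with property `A`. -/
def Undo (hj hp : ℕ → ℕ) (A : (ℕ → ℕ) → Prop) : ℕ → (ℕ → ℕ) → Prop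
  | 0, ρ => A ρ
  | i + 1, ρ => Undo hj hp A i (I.prune ρ (hj i) (hp i))

/-- A push writes only at the stack height, so the records below it keep their meaning. -/
theorem Undo.congr {hj hp hj' hp' : ℕ → ℕ} {A : (ℕ → ℕ) → Prop} {i : ℕ}
    (h₁ : ∀ k < i, hj' k = hj k) (h₂ : ∀ k < i, hp' k = hp k) {ρ : ℕ → ℕ}
    (h : I.Undo hj hp A i ρ) : I.Undo hj' hp' A i ρ := by
  induction i generalizing ρ with
  | zero => exact h
  | succ i ih =>
    rw [Undo] at h ⊢
    rw [h₁ i (by omega), h₂ i (by omega)]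
    exact ih (fun k hk => h₁ k (by omega)) (fun k hk => h₂ k (by omega)) h

end DueDates

/-! ### From schedules to due dates and back -/

namespace GSP

variable (I : GSP)

theorem costAt_mono (j : Fin I.n) : Monotone (I.costAt j) := fun _ _ h =>
  Finset.sum_le_sum_of_subset (Finset.Ioc_subset_Ioc_right h)

/-- The common release time, as it is found in the memory. -/
def release : ℕ := I.inputMem 1 0

/-- The size of job `j`, as it is found in the memory. -/
def size (j : ℕ) : ℕ := I.inputMem 2 j

theorem size_eq (j : Fin I.n) : I.size j = I.p j := by simp [size, inputMem]

theorem sum_size (f : ℕ → ℕ) :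
    ∑ j ∈ Finset.range I.n, f j = ∑ j : Fin I.n, f j := (Fin.sum_univ_eq_sum_range f I.n).symm

variable {I}

theorem doublingTime_spec {j k : ℕ} (h : I.doublingTime j k ≠ 0) :
    ∃ hj : j < I.n, I.r ⟨j, hj⟩ < I.doublingTime j k ∧ I.doublingTime j k ≤ I.horizon ∧
      2 ^ k ≤ I.costAt ⟨j, hj⟩ (I.doublingTime j k) := by
  unfold doublingTime at h ⊢
  exact Nat.sInf_mem (Nat.nonempty_of_pos_sInf (Nat.pos_of_ne_zero h))

theorem doublingTime_le {j : Fin I.n} {k t : ℕ} (h₁ : I.r j < t) (h₂ : t ≤ I.horizon)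
    (h₃ : 2 ^ k ≤ I.costAt j t) : I.doublingTime j k ≠ 0 ∧ I.doublingTime j k ≤ t := by
  have hmem : t ∈ {t | ∃ h : j.1 < I.n, I.r ⟨j, h⟩ < t ∧ t ≤ I.horizon ∧
      2 ^ k ≤ I.costAt ⟨j, h⟩ t} := ⟨j.2, h₁, h₂, h₃⟩
  refine ⟨?_, Nat.sInf_le hmem⟩
  obtain ⟨_, h, -⟩ := Nat.sInf_mem ⟨t, hmem⟩
  exact (Nat.zero_le _).trans_lt h |>.ne'

theorem doublingTime_le_horizon (j k : ℕ) : I.doublingTime j k ≤ I.horizon := by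
  by_cases h : I.doublingTime j k = 0
  · omega
  · exact (doublingTime_spec h).2.2.1

theorem doublingTime_anti {j k l : ℕ} (hkl : k ≤ l) (h : I.doublingTime j k = 0) :
    I.doublingTime j l = 0 := by
  by_contra hl
  obtain ⟨hj, h1, h2, h3⟩ := doublingTime_spec hl
  exact (doublingTime_le (j := ⟨j, hj⟩) h1 h2
    ((Nat.pow_le_pow_right (by norm_num) hkl).trans h3)).1 h

/-- A cost up to the horizon is a sum of at most `I.horizon` weights. Hence only logarithmically
many levels, and so polynomially many due dates, are needed. -/
theorem pow_le_of_doublingTime_ne_zero {j k : ℕ} (h : I.doublingTime j k ≠ 0) :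
    2 ^ k ≤ I.maxWeight * I.horizon := by
  obtain ⟨hj, h1, h2, h3⟩ := doublingTime_spec h
  refine h3.trans ((I.costAt_mono _ h2).trans ?_)
  refine (Finset.sum_le_card_nsmul _ _ I.maxWeight fun s hs => ?_).trans ?_
  · exact (Finset.le_sup (f := I.w ⟨j, hj⟩) hs).trans
      (Finset.le_sup (f := fun j => (Finset.Ioc (I.r j) I.horizon).sup (I.w j))
        (Finset.mem_univ _))
  · rw [Nat.card_Ioc, smul_eq_mul, mul_comm]
    exact Nat.mul_le_mul_left _ (Nat.sub_le _ _)

theorem r_eq_release (hr : ∀ i j, I.r i = I.r j) (j : Fin I.n) : I.r j = I.release := by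
  have : 0 < I.n := j.pos
  rw [hr j ⟨0, this⟩]
  simp [release, inputMem, this]

theorem horizon_eq (hr : ∀ i j, I.r i = I.r j) :
    I.horizon = I.release + ∑ j ∈ Finset.range I.n, I.size j := by
  rw [horizon, sum_size]
  congr 1
  · rcases Nat.eq_zero_or_pos I.n with h | h
    · have : IsEmpty (Fin I.n) := by rw [h]; infer_instance
      rw [maxRelease, Finset.univ_eq_empty, Finset.sup_empty]
      simp [release, inputMem, h]
    · apply le_antisymm
      · exact Finset.sup_le fun j _ => (r_eq_release hr j).le
      · rw [← r_eq_release hr ⟨0, h⟩]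
        exact Finset.le_sup (Finset.mem_univ _)
  · exact Finset.sum_congr rfl fun j _ => (I.size_eq j).symm

/-- The latest time, up to the horizon, at which the completion of job `j` costs less
than `2 ^ k`. -/
noncomputable def dueDate (I : GSP) (j k : ℕ) : ℕ :=
  if I.doublingTime j k = 0 then I.horizon else I.doublingTime j k - 1

/-- The level `k` stands for costs between `levelCost k` and `2 * levelCost k`. -/
def levelCost (k : ℕ) : ℕ := if k = 0 then 0 else 2 ^ (k - 1)

theorem dueDate_le_horizon (j k : ℕ) : I.dueDate j k ≤ I.horizon := by
  have := I.doublingTime_le_horizon j k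
  unfold dueDate
  split_ifs <;> omega

/-- The cost at the due date is still below `2 ^ k`. This forces zero at level 0, and otherwise `2 ^
k` is twice the level cost. -/
theorem costAt_dueDate_le (j : Fin I.n) (k : ℕ) :
    I.costAt j (I.dueDate j k) ≤ 2 * levelCost k := by
  have hlt : I.costAt j (I.dueDate j k) < 2 ^ k := by
    by_contra! h
    by_cases ht : I.r j < I.dueDate j k
    · have := doublingTime_le ht (dueDate_le_horizon _ _) h
      unfold dueDate at this
      split_ifs at this <;> omega
    · rw [costAt, Finset.Ioc_eq_empty (by omega)] at h
      simp at h
  unfold levelCost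
  split_ifs with h
  · subst h; omega
  · have : 2 ^ k = 2 * 2 ^ (k - 1) := by rw [← pow_succ']; congr 1; omega
    omega

/-- Every completion time lies before a due date of no higher level cost. -/
theorem exists_level {K : ℕ} (hK : ∀ j < I.n, I.doublingTime j K = 0) (j : Fin I.n) {C : ℕ}
    (hC : C ≤ I.horizon) :
    ∃ l ≤ K, C ≤ I.dueDate j l ∧ levelCost l ≤ I.costAt j C := by
  classical
  have hex : ∃ l, C ≤ I.dueDate j l := ⟨K, by rwa [dueDate, if_pos (hK j j.2)]⟩
  refine ⟨Nat.find hex, Nat.find_min' hex (by rwa [dueDate, if_pos (hK j j.2)]),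
    Nat.find_spec hex, ?_⟩
  unfold levelCost
  split_ifs with h
  · exact Nat.zero_le _
  -- By minimality `C` lies beyond the due date one level lower, so the cost has already reached
  -- that level's power of two.
  · have hmin := Nat.find_min hex (show Nat.find hex - 1 < Nat.find hex by omega)
    unfold dueDate at hmin
    split_ifs at hmin with h0
    · exact absurd hC hmin
    · obtain ⟨_, -, -, h3⟩ := doublingTime_spec h0
      exact h3.trans (I.costAt_mono _ (by omega))

/-- The due dates offered to the jobs: `K + 1` for each job. -/
noncomputable def dueDates (hr : ∀ i j, I.r i = I.r j) (K : ℕ)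
    (hK : ∀ j < I.n, I.doublingTime j K = 0) : DueDates where
  n := I.n
  L := K + 1
  r := I.release
  p := I.size
  E q := I.dueDate (q / (K + 1)) (q % (K + 1))
  p_pos j hj := by rw [I.size_eq ⟨j, hj⟩]; exact I.p_pos _
  L_pos := K.succ_pos
  le_E q hq := by
    have hj : q / (K + 1) < I.n := by rwa [Nat.div_lt_iff_lt_mul K.succ_pos]
    have h := r_eq_release hr ⟨_, hj⟩
    unfold dueDate
    split_ifs with h0
    · rw [horizon_eq hr]; omega
    · obtain ⟨_, h1, -⟩ := doublingTime_spec h0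
      omega
  E_top j hj := by
    have h1 : (j * (K + 1) + (K + 1 - 1)) / (K + 1) = j := by
      rw [mul_comm, Nat.mul_add_div K.succ_pos, Nat.div_eq_of_lt (by omega), add_zero]
    have h2 : (j * (K + 1) + (K + 1 - 1)) % (K + 1) = K := by
      rw [mul_comm, Nat.mul_add_mod, Nat.mod_eq_of_lt (by omega)]; rfl
    rw [h1, h2, dueDate, if_pos (hK j hj), horizon_eq hr]

/-! ### From a schedule to an assignment of due dates. -/

section reduction

variable (hr : ∀ i j, I.r i = I.r j) {K : ℕ} (hK : ∀ j < I.n, I.doublingTime j K = 0)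

theorem dueDates_H : (dueDates hr K hK).H = I.horizon := (horizon_eq hr).symm

/-- In a feasible schedule, the jobs completed by time `e` have total size at most `e - r`. -/
theorem sum_size_le {σ : I.Schedule} (hσ : I.Feasible σ) {r e : ℕ} (hr : ∀ j, r ≤ I.r j)
    (A : Finset (Fin I.n)) (hA : ∀ j ∈ A, I.completion σ j ≤ e) : ∑ j ∈ A, I.p j ≤ e - r := by
  classical
  have h1 : ∀ j, I.p j = ((hσ.finite j).toFinset).card := fun j => by
    rw [← hσ.processed j, Set.ncard_eq_toFinset_card _ (hσ.finite j)]
  rw [Finset.sum_congr rfl fun j _ => h1 j, ← Finset.card_biUnion, ← Nat.card_Ioc]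
  · apply Finset.card_le_card
    intro s hs
    simp only [Finset.mem_biUnion, Set.Finite.mem_toFinset] at hs
    obtain ⟨j, hj, hs⟩ := hs
    rw [Finset.mem_Ioc]
    exact ⟨(hr j).trans_lt (hσ.released j s hs),
      (le_csSup (hσ.finite j).bddAbove hs).trans (hA j hj)⟩
  · intro i _ j _ hij
    rw [Function.onFun, Finset.disjoint_left]
    intro s hs hs'
    rw [Set.Finite.mem_toFinset] at hs hs'
    exact hij (Option.some_injective _ (Eq.trans (Eq.symm hs) hs'))

/-- A feasible schedule gives a feasible assignment of due dates of no higher cost. -/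
theorem exists_assignment {σ : I.Schedule} (hσ : I.Feasible σ) :
    ∃ o, (dueDates hr K hK).Fits o ∧ (dueDates hr K hK).Feas o ∧
      ∑ j ∈ Finset.range I.n, levelCost (o j % (K + 1)) ≤ I.cost σ := by
  classical
  -- Due dates end at the horizon, so completion times are cut off there. By monotonicity this does
  -- not increase costs.
  choose l hlK hle hcost using fun j : Fin I.n =>
    exists_level hK j (min_le_right (I.completion σ j) I.horizon)
  set o : ℕ → ℕ := fun j => j * (K + 1) + if h : j < I.n then l ⟨j, h⟩ else 0 with ho
  have hoj : ∀ j : Fin I.n, o j = j * (K + 1) + l j := fun j => by simp [ho]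
  have hdiv : ∀ j : Fin I.n, o j / (K + 1) = j := fun j => by
    have := hlK j
    rw [hoj, mul_comm, Nat.mul_add_div K.succ_pos, Nat.div_eq_of_lt (by omega), add_zero]
  have hmod : ∀ j : Fin I.n, o j % (K + 1) = l j := fun j => by
    have := hlK j
    rw [hoj, mul_comm, Nat.mul_add_mod, Nat.mod_eq_of_lt (by omega)]
  refine ⟨o, fun j hj => hdiv ⟨j, hj⟩, fun q hq => ?_, ?_⟩
  · have hE : ∀ j : Fin I.n, (dueDates hr K hK).E (o j) = I.dueDate j (l j) := fun j => by
      change I.dueDate (o j / (K + 1)) (o j % (K + 1)) = _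
      rw [hdiv, hmod]
    rw [DueDates.deficit, dueDates_H]
    have hge := (dueDates hr K hK).le_E q hq
    set e := (dueDates hr K hK).E q
    by_cases he : I.horizon ≤ e
    · omega
    · have hcov : (dueDates hr K hK).cov o e =
          ∑ j : Fin I.n, if e < I.dueDate j (l j) then I.p j else 0 := by
        refine (I.sum_size _).trans (Finset.sum_congr rfl fun j _ => ?_)
        rw [hE]
        exact if_congr Iff.rfl (I.size_eq j) rfl
      -- Jobs due by `e`, which is before the horizon, are completed by `e` and fit into `e - r`
      -- slots. The remaining jobs therefore cover `H - e`.
      have hsum := sum_size_le hσ (fun j => (r_eq_release hr j).ge)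
        (Finset.univ.filter fun j => ¬ e < I.dueDate j (l j)) (e := e) (fun j hj => by
          have := hle j
          rw [Finset.mem_filter] at hj
          omega)
      have htot : _ + _ = ∑ j, I.p j := Finset.sum_filter_add_sum_filter_not Finset.univ
        (fun j : Fin I.n => e < I.dueDate j (l j)) I.p
      rw [← Finset.sum_filter] at hcov
      have hh := horizon_eq hr
      have hp : ∑ j : Fin I.n, I.size j = ∑ j, I.p j :=
        Finset.sum_congr rfl fun j _ => I.size_eq j
      rw [sum_size, hp] at hh
      have hge' : I.release ≤ e := hge
      omega
  · rw [sum_size]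
    refine Finset.sum_le_sum fun j _ => ?_
    rw [hmod]
    exact (hcost j).trans (I.costAt_mono j (min_le_left _ _))

end reduction

/-- Jobs are processed in the order of their due dates, ties being broken by their indices. -/
def Before (d : ℕ → ℕ) (l j : ℕ) : Prop := d l < d j ∨ d l = d j ∧ l < j

instance (d : ℕ → ℕ) (l j : ℕ) : Decidable (Before d l j) := inferInstanceAs (Decidable (_ ∨ _))

/-- The time at which job `j` is started when the jobs are processed in this order. -/
def startTime (I : GSP) (d : ℕ → ℕ) (j : ℕ) : ℕ :=
  I.release + ∑ l ∈ Finset.range I.n, if Before d l j then I.size l else 0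

/-- By transitivity, whatever precedes `i` also precedes `j`, as does `i` itself. This makes the
processing intervals disjoint. -/
theorem startTime_add_le (d : ℕ → ℕ) {i j : ℕ} (hi : i < I.n) (h : Before d i j) :
    I.startTime d i + I.size i ≤ I.startTime d j := by
  have hmem : i ∈ Finset.range I.n := Finset.mem_range.2 hi
  have h1 : (∑ l ∈ Finset.range I.n, if Before d l i then I.size l else 0) + I.size i ≤
      ∑ l ∈ Finset.range I.n, if Before d l j then I.size l else 0 := by
    rw [← Finset.add_sum_erase _ _ hmem, ← Finset.add_sum_erase _ _ hmem, if_pos h,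
      if_neg (by unfold Before; omega), zero_add, add_comm]
    gcongr with l hl
    by_cases hb : Before d l i
    · rw [if_pos hb, if_pos (by unfold Before at *; omega)]
    · rw [if_neg hb]; exact Nat.zero_le _
  unfold startTime
  omega

/-- The schedule that processes the jobs in the order of the due dates. -/
noncomputable def orderedSchedule (I : GSP) (d : ℕ → ℕ) : I.Schedule := fun s =>
  open Classical in
  if h : ∃ j : Fin I.n, I.startTime d j < s ∧ s ≤ I.startTime d j + I.size j
  then some h.choose else none

theorem orderedSchedule_eq_some (d : ℕ → ℕ) (s : ℕ) (j : Fin I.n) :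
    I.orderedSchedule d s = some j ↔ I.startTime d j < s ∧ s ≤ I.startTime d j + I.size j := by
  classical
  unfold orderedSchedule
  constructor
  · intro h
    split_ifs at h with hex
    rw [← Option.some_injective _ h]
    exact hex.choose_spec
  · intro h
    have hex : ∃ j : Fin I.n, I.startTime d j < s ∧ s ≤ I.startTime d j + I.size j := ⟨j, h⟩
    rw [dif_pos hex]
    congr 1
    by_contra hne
    have hne' : hex.choose.1 ≠ j.1 := fun h => hne (Fin.ext h)
    have h2 := hex.choose_spec
    have : Before d hex.choose j ∨ Before d j hex.choose := by unfold Before; omega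
    rcases this with hb | hb
    · have := startTime_add_le (I := I) d hex.choose.2 hb
      omega
    · have := startTime_add_le (I := I) d j.2 hb
      omega

theorem slots_orderedSchedule (d : ℕ → ℕ) (j : Fin I.n) :
    I.slots (I.orderedSchedule d) j =
      Finset.Ioc (I.startTime d j) (I.startTime d j + I.size j) := by
  ext s
  simp [slots, orderedSchedule_eq_some]

theorem completion_orderedSchedule (d : ℕ → ℕ) (j : Fin I.n) :
    I.completion (I.orderedSchedule d) j = I.startTime d j + I.size j := by
  have := I.p_pos j
  rw [← size_eq] at this
  rw [completion, slots_orderedSchedule, Finset.coe_Ioc, csSup_Ioc (by omega)]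

theorem feasible_orderedSchedule (hr : ∀ i j, I.r i = I.r j) (d : ℕ → ℕ) :
    I.Feasible (I.orderedSchedule d) where
  released j s hs := by
    rw [slots_orderedSchedule, Finset.coe_Ioc] at hs
    rw [r_eq_release hr]
    exact (Nat.le_add_right _ _).trans_lt hs.1
  finite j := by rw [slots_orderedSchedule]; exact Finset.finite_toSet _
  processed j := by
    rw [slots_orderedSchedule, Set.ncard_coe_finset, Nat.card_Ioc, size_eq, Nat.add_sub_cancel_left]

/-! ### From an assignment of due dates to a schedule. -/

section reduction

variable (hr : ∀ i j, I.r i = I.r j) {K : ℕ} (hK : ∀ j < I.n, I.doublingTime j K = 0)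

/-- Jobs processed up to and including `j` are disjoint from those due after `d j`. Feasibility at
`d j` makes the latter at least `H - d j` in size, leaving at most `d j - r` for the former. -/
theorem startTime_add_le_dueDate {ρ : ℕ → ℕ} (hf : (dueDates hr K hK).Fits ρ)
    (h : (dueDates hr K hK).Feas ρ) {j : ℕ} (hj : j < I.n) :
    I.startTime (fun l => (dueDates hr K hK).E (ρ l)) j + I.size j ≤
      (dueDates hr K hK).E (ρ j) := by
  have h1 := h _ (hf.lt hj)
  rw [DueDates.deficit, dueDates_H, horizon_eq hr] at h1
  set d := fun l => (dueDates hr K hK).E (ρ l) with hd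
  change _ ≤ d j
  change _ - d j - _ = 0 at h1
  have hmem : j ∈ Finset.range I.n := Finset.mem_range.2 hj
  have h2 : (∑ l ∈ Finset.range I.n, if Before d l j then I.size l else 0) + I.size j +
      (dueDates hr K hK).cov ρ (d j) ≤ ∑ l ∈ Finset.range I.n, I.size l := by
    change _ + (∑ l ∈ Finset.range I.n, if d j < d l then I.size l else 0) ≤ _
    rw [← Finset.add_sum_erase _ _ hmem, ← Finset.add_sum_erase _ _ hmem,
      ← Finset.add_sum_erase _ _ hmem, if_neg (by unfold Before; omega), if_neg (lt_irrefl _),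
      zero_add, zero_add, add_right_comm, ← Finset.sum_add_distrib, add_comm]
    gcongr with l hl
    by_cases hb : Before d l j
    · rw [if_pos hb, if_neg (by unfold Before at hb; omega), add_zero]
    · rw [if_neg hb]; split_ifs <;> omega
  unfold startTime
  change _ - d j - (dueDates hr K hK).cov ρ (d j) = 0 at h1
  omega

/-- A good assignment of due dates yields a schedule of cost at most eight times the optimum. -/
theorem cost_orderedSchedule_le {cur G ρ : ℕ → ℕ} (h : (dueDates hr K hK).Good cur G ρ)
    (hG : ∀ q < I.n * (K + 1), G q =
      (∑ j ∈ Finset.range I.n, I.size j + 1) * levelCost (q % (K + 1)))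
    {σ : I.Schedule} (hσ : I.Feasible σ) :
    I.cost (I.orderedSchedule fun l => (dueDates hr K hK).E (ρ l)) ≤ 8 * I.cost σ := by
  obtain ⟨o, ho, hof, hoc⟩ := exists_assignment hr hK hσ
  have h1 : I.cost (I.orderedSchedule fun l => (dueDates hr K hK).E (ρ l)) ≤
      2 * ∑ j ∈ Finset.range I.n, levelCost (ρ j % (K + 1)) := by
    rw [sum_size, Finset.mul_sum]
    refine Finset.sum_le_sum fun j _ => ?_
    rw [completion_orderedSchedule]
    refine (I.costAt_mono j (startTime_add_le_dueDate hr hK h.fits h.feas j.2)).trans ?_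
    have h2 : ρ j / (K + 1) = j := h.fits j j.2
    change I.costAt j (I.dueDate (ρ j / (K + 1)) (ρ j % (K + 1))) ≤ _
    rw [h2]
    exact costAt_dueDate_le j _
  have h2 := h.cost o ho hof
  set S := ∑ j ∈ Finset.range I.n, I.size j with hS
  have h3 : ∑ j ∈ Finset.range I.n, G (o j) =
      (S + 1) * ∑ j ∈ Finset.range I.n, levelCost (o j % (K + 1)) := by
    rw [Finset.mul_sum]
    exact Finset.sum_congr rfl fun j hj => hG _ (ho.lt (Finset.mem_range.1 hj))
  have h4 : (S + 1) * ∑ j ∈ Finset.range I.n, levelCost (ρ j % (K + 1)) ≤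
      ∑ j ∈ Finset.range I.n, (G (ρ j) - I.size j) + S := by
    rw [Finset.mul_sum]
    refine (Finset.sum_le_sum fun j hj => ?_).trans_eq Finset.sum_add_distrib
    rw [hG _ (h.fits.lt (Finset.mem_range.1 hj))]
    omega
  change ∑ j ∈ Finset.range I.n, (G (ρ j) - I.size j) ≤ 4 * ∑ j ∈ Finset.range I.n, G (o j) at h2
  rw [h3] at h2
  set x := ∑ j ∈ Finset.range I.n, levelCost (ρ j % (K + 1))
  set y := ∑ j ∈ Finset.range I.n, levelCost (o j % (K + 1))
  -- Both costs are multiples of `S + 1`, so the additive error `S` disappears on dividing, giving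
  -- `x ≤ 4 * y`.
  have h5 : (S + 1) * x < (S + 1) * (4 * y + 1) := by nlinarith
  have h6 := Nat.lt_of_mul_lt_mul_left h5
  omega

end reduction

end GSP

/-! ### Writing programs -/

namespace RAM

namespace Expr

instance : Add Expr := ⟨.op .add⟩
instance : Sub Expr := ⟨.op .sub⟩
instance : Mul Expr := ⟨.op .mul⟩
instance : Div Expr := ⟨.op .div⟩

/-- The comparison `x < y`. -/
def lt (x y : Expr) : Expr := .op .lt x y

/-- The comparison `x = y`. -/
def eq (x y : Expr) : Expr := .op .eq x y

/-- Register `0` of array `a`. -/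
def var (a : ℕ) : Expr := .read a (.const 0)

variable (m : Mem) (x y : Expr)

@[simp] theorem eval_const (c : ℕ) : (const c).eval m = c := rfl
@[simp] theorem eval_read (a : ℕ) : (read a x).eval m = m a (x.eval m) := rfl
@[simp] theorem eval_var (a : ℕ) : (var a).eval m = m a 0 := rfl
@[simp] theorem eval_add : (x + y).eval m = x.eval m + y.eval m := rfl
@[simp] theorem eval_sub : (x - y).eval m = x.eval m - y.eval m := rfl
@[simp] theorem eval_mul : (x * y).eval m = x.eval m * y.eval m := rfl
@[simp] theorem eval_div : (x / y).eval m = x.eval m / y.eval m := rfl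
@[simp] theorem eval_lt : (x.lt y).eval m = if x.eval m < y.eval m then 1 else 0 := rfl
@[simp] theorem eval_eq : (x.eq y).eval m = if x.eval m = y.eval m then 1 else 0 := rfl

end Expr

namespace Prog

/-- Assign a value to register `0` of array `a`. -/
def set (a : ℕ) (e : Expr) : Prog := .write a (.const 0) e

/-- Sum up `term` over the values of the counter `i` below the bound `N`. -/
def sumLoop (acc i N : ℕ) (term : Expr) : Prog :=
  .seq (set acc (.const 0)) (forLoop i N (set acc (.var acc + term)))

end Prog

infixr:60 " ;; " => Prog.seq

section rules

variable {X : ℕ} {O : ℕ → ℕ → ℕ} {Q : Mem → Prop} {m : Mem}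

theorem wp_set {a : ℕ} {e : Expr} (hv : e.eval m < 2 ^ X) (h : Q (m.write a 0 (e.eval m))) :
    WP X O (.set a e) Q m := wp_write hv h

theorem lt_two_pow_of_le {a : ℕ} (h : a ≤ X) : a < 2 ^ X := h.trans_lt Nat.lt_two_pow_self

theorem wp_sumLoop {acc i N : ℕ} {term : Expr} (f : ℕ → ℕ) (hai : acc ≠ i) (hN : N ≠ i)
    (hNa : N ≠ acc) (hX : m N 0 ≤ X)
    (hterm : ∀ k < m N 0, ∀ m', m' i 0 = k → (∀ a, a ≠ i → a ≠ acc → m' a = m a) →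
      term.eval m' = f k)
    (hb : ∑ k ∈ Finset.range (m N 0), f k < 2 ^ X)
    (h : ∀ m', m' acc 0 = ∑ k ∈ Finset.range (m N 0), f k →
      (∀ a, a ≠ i → a ≠ acc → m' a = m a) → Q m') :
    WP X O (.sumLoop acc i N term) Q m := by
  apply wp_seq
  apply wp_set (by simp)
  have hmods : ∀ a, (Prog.set acc (.var acc + term)).mods a = (a == acc) := fun _ => rfl
  apply wp_for (fun k m' => m' acc 0 = ∑ k ∈ Finset.range k, f k)
  · simp [hmods, hai.symm]
  · simp [hmods, hNa]
  · exact hN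
  · simpa [hNa] using hX
  · simp [hai]
  · intro k m' hk hI hki _ hfr
    simp only [Mem.write_of_ne _ _ _ hNa] at hk
    have ht : term.eval m' = f k := by
      refine hterm k hk m' hki fun a ha ha' => ?_
      rw [hfr a ha (by simp [hmods, ha']), Mem.write_of_ne _ _ _ ha']
    have hv : (Expr.var acc + term).eval m' = ∑ k ∈ Finset.range (k + 1), f k := by
      rw [Expr.eval_add, Expr.eval_var, hI, ht, Finset.sum_range_succ]
    apply wp_set
    · rw [hv]
      exact (Finset.sum_le_sum_of_subset (Finset.range_subset_range.2 hk)).trans_lt hb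
    · rw [hv]; simp [hai]
  · intro m' hI hfr
    simp only [Mem.write_of_ne _ _ _ hNa] at hI
    refine h m' hI fun a ha ha' => ?_
    rw [hfr a ha (by simp [hmods, ha']), Mem.write_of_ne _ _ _ ha']

end rules

end RAM

/-! ### The main loop

The arrays are used as follows.
* `0`, `1`, `2`: the input; `3`, `4`, `5`, `6`: the output;
* `7`: total size; `8`: horizon; `9`: largest level; `10`: number of levels; `11`: number of due
  dates;
* `12`: due dates; `13`: their residual costs; `14`: the due dates chosen for the jobs;
* `15`, `16`, `17`: jobs on the stack, their previous due dates, height of the stack;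
* `18`, `23`, `24`: counters; `19`: answer of the oracle; `20`: accumulator for sums;
* `21`, `22`: the largest deficit and the time at which it is attained;
* `25`, `26`: the smallest ratio and the due date at which it is attained;
* `27`, `28`, `29`: auxiliary values.
-/

namespace DueDates

open RAM

/-- The memory contains the data of the problem. -/
structure Ready (I : DueDates) (m : Mem) : Prop where
  n : m 0 0 = I.n
  r : m 1 0 = I.r
  p : m 2 = I.p
  H : m 8 0 = I.H
  L : m 10 0 = I.L
  N : m 11 0 = I.n * I.L
  E : ∀ q < I.n * I.L, m 12 q = I.E q

/-- All numbers occurring have at most `X` bits. -/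
structure Small (I : DueDates) (X : ℕ) : Prop where
  n_le : I.n ≤ X
  N_le : I.n * I.L ≤ X
  H_lt : I.H < 2 ^ X

variable {I : DueDates} {X : ℕ} {O : ℕ → ℕ → ℕ} {m : Mem}

theorem Ready.congr (h : I.Ready m) {m' : Mem} (h0 : m' 0 = m 0) (h1 : m' 1 = m 1)
    (h2 : m' 2 = m 2) (h8 : m' 8 = m 8) (h10 : m' 10 = m 10) (h11 : m' 11 = m 11)
    (h12 : m' 12 = m 12) : I.Ready m' := by
  constructor
  · rw [h0, h.n]
  · rw [h1, h.r]
  · rw [h2, h.p]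
  · rw [h8, h.H]
  · rw [h10, h.L]
  · rw [h11, h.N]
  · rw [h12]; exact h.E

theorem cov_le (ρ : ℕ → ℕ) (e : ℕ) : I.cov ρ e ≤ I.H := by
  refine le_trans (Finset.sum_le_sum fun j _ => ?_) (Nat.le_add_left _ _)
  split_ifs <;> simp

/-- Compute the total size of the jobs due after the time in array `27`. -/
def covProg : Prog :=
  .sumLoop 20 24 0 ((Expr.var 27).lt (.read 12 (.read 14 (.var 24))) * .read 2 (.var 24))

theorem wp_covProg (hs : I.Small X) (hR : I.Ready m) (hf : I.Fits (m 14)) :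
    WP X O covProg (fun m' => m' 20 0 = I.cov (m 14) (m 27 0)) m := by
  have hn := hR.n
  apply wp_sumLoop (fun j => if m 27 0 < I.E (m 14 j) then I.p j else 0) (by decide) (by decide)
    (by decide) (hn.trans_le hs.n_le)
  · intro k hk m' hk' hfr
    rw [hn] at hk
    simp [hk', hfr 12 (by decide) (by decide), hfr 14 (by decide) (by decide),
      hfr 2 (by decide) (by decide), hfr 27 (by decide) (by decide), hR.p, hR.E _ (hf.lt hk)]
  · rw [hn]; exact (cov_le (m 14) (m 27 0)).trans_lt hs.H_lt
  · intro m' h _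
    rw [h, hn]; rfl

/-- Compute the largest deficit. -/
def deficitProg : Prog :=
  .set 21 (.const 0) ;; .set 22 (.const 0) ;;
  .forLoop 23 11 (
    .set 27 (.read 12 (.var 23)) ;;
    covProg ;;
    .set 28 (.var 8 - .var 27 - .var 20) ;;
    .ite ((Expr.var 21).lt (.var 28)) (.set 21 (.var 28) ;; .set 22 (.var 27)) .skip)

theorem wp_deficitProg (hs : I.Small X) (hR : I.Ready m) (hf : I.Fits (m 14)) :
    WP X O deficitProg (fun m' => (∀ q < I.n * I.L, I.deficit (m 14) q ≤ m' 21 0) ∧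
      (0 < m' 21 0 → ∃ q < I.n * I.L, m' 22 0 = I.E q ∧ I.deficit (m 14) q = m' 21 0)) m := by
  apply wp_seq
  apply wp_set (by simp)
  apply wp_seq
  apply wp_set (by simp)
  apply wp_for (fun k m' => (∀ q < k, I.deficit (m 14) q ≤ m' 21 0) ∧
      (0 < m' 21 0 → ∃ q < I.n * I.L, m' 22 0 = I.E q ∧ I.deficit (m 14) q = m' 21 0))
    rfl rfl (by decide)
  · simpa [hR.N] using hs.N_le
  · simp
  · rintro k m' hk ⟨h1, h2⟩ hk' hb hfr
    have hk : k < I.n * I.L := by simpa [hR.N] using hk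
    have hR' : I.Ready m' := hR.congr (hfr 0 (by decide) rfl) (hfr 1 (by decide) rfl)
      (hfr 2 (by decide) rfl) (hfr 8 (by decide) rfl) (hfr 10 (by decide) rfl)
      (hfr 11 (by decide) rfl) (hfr 12 (by decide) rfl)
    have h14 : m' 14 = m 14 := hfr 14 (by decide) rfl
    have hE := hR'.E k hk
    have hHlt := hs.H_lt
    apply wp_seq
    apply wp_set (hb _ _)
    apply wp_seq
    refine (wp_covProg hs (hR'.congr ?_ ?_ ?_ ?_ ?_ ?_ ?_) ?_).mono ?_
    iterate 7 simp
    · simpa [h14] using hf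
    intro m₁ hb₁ hfr₁ hc
    simp only [Expr.eval_read, Expr.eval_var, hk', hE, h14, Mem.write_same, Function.update_self,
      ne_eq, Nat.reduceEqDiff, not_false_eq_true, Mem.write_of_ne] at hc hfr₁
    have h8 : m₁ 8 0 = I.H := by rw [hfr₁ 8 rfl, Mem.write_of_ne _ _ _ (by decide), hR'.H]
    have h27 : m₁ 27 0 = I.E k := by simp [hfr₁ 27 rfl]
    have h21 : m₁ 21 0 = m' 21 0 := by simp [hfr₁ 21 rfl]
    have h22 : m₁ 22 0 = m' 22 0 := by simp [hfr₁ 22 rfl]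
    have hd : I.H - I.E k - I.cov (m 14) (I.E k) = I.deficit (m 14) k := rfl
    have hdlt : I.deficit (m 14) k < 2 ^ X := by omega
    apply wp_seq
    apply wp_set
    · simp [h8, h27, hc, hd, hdlt]
    simp only [Expr.eval_sub, Expr.eval_var, h8, h27, hc, hd]
    apply wp_ite
    · intro hlt
      have hlt : m' 21 0 < I.deficit (m 14) k := by simpa [h21] using hlt
      apply wp_seq
      apply wp_set (by simpa using hdlt)
      apply wp_set (by simpa [h27] using (hE ▸ hb 12 k))
      simp only [Expr.eval_var, Mem.write_same, Function.update_self, ne_eq,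
        Nat.reduceEqDiff, not_false_eq_true, Mem.write_of_ne]
      refine ⟨fun q hq => ?_, fun _ => ⟨k, hk, h27, rfl⟩⟩
      rcases Nat.lt_succ_iff_lt_or_eq.1 hq with h | h
      · exact (h1 q h).trans hlt.le
      · rw [h]
    · intro hlt
      have hlt : I.deficit (m 14) k ≤ m' 21 0 := by simpa [h21] using hlt
      apply wp_skip
      simp only [ne_eq, Nat.reduceEqDiff, not_false_eq_true, Mem.write_of_ne, h21, h22]
      refine ⟨fun q hq => ?_, h2⟩
      rcases Nat.lt_succ_iff_lt_or_eq.1 hq with h | h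
      · exact h1 q h
      · rw [h]; exact hlt
  · rintro m' h _
    simpa [hR.N] using h

end DueDates

/-! ### The local-ratio step, the main loop and the undoing phase as programs. -/

namespace DueDates

open RAM

variable {I : DueDates} {X : ℕ} {O : ℕ → ℕ → ℕ} {m : Mem}

/-- The condition that the due date with the index in array `23` is eligible. -/
def eligibleExpr : Expr :=
  (Expr.const 1 - (Expr.var 22).lt (.read 12 (.read 14 (.var 23 / .var 10)))) *
    (Expr.var 22).lt (.read 12 (.var 23))

/-- The minimum of the size of the job of this due date and the largest deficit. -/
def truncExpr : Expr :=
  (Expr.read 2 (.var 23 / .var 10)).lt (.var 21) * .read 2 (.var 23 / .var 10) +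
    (Expr.const 1 - (Expr.read 2 (.var 23 / .var 10)).lt (.var 21)) * .var 21

theorem div_lt {q : ℕ} (hq : q < I.n * I.L) : q / I.L < I.n := by
  rwa [Nat.div_lt_iff_lt_mul I.L_pos]

theorem eval_eligibleExpr (hR : I.Ready m) (hf : I.Fits (m 14)) (hq : m 23 0 < I.n * I.L) :
    eligibleExpr.eval m = if I.Eligible (m 14) (m 22 0) (m 23 0) then 1 else 0 := by
  have h1 := hR.E _ (hf.lt (div_lt hq))
  have h2 := hR.E _ hq
  simp only [eligibleExpr, Expr.eval_mul, Expr.eval_sub, Expr.eval_const, Expr.eval_lt,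
    Expr.eval_read, Expr.eval_var, Expr.eval_div, hR.L, h1, h2]
  by_cases h : I.Eligible (m 14) (m 22 0) (m 23 0)
  · rw [if_pos h]
    unfold Eligible at h
    rw [if_neg (by omega), if_pos h.2]
  · rw [if_neg h]
    unfold Eligible at h
    split_ifs <;> omega

theorem eval_truncExpr (hR : I.Ready m) :
    truncExpr.eval m = min (I.p (m 23 0 / I.L)) (m 21 0) := by
  simp only [truncExpr, Expr.eval_add, Expr.eval_mul, Expr.eval_sub, Expr.eval_const, Expr.eval_lt,
    Expr.eval_read, Expr.eval_var, Expr.eval_div, hR.L, hR.p]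
  split_ifs <;> omega

/-- Find the eligible due date with the smallest ratio. -/
def ratioProg : Prog :=
  .set 25 (.const 0) ;; .set 26 (.var 11) ;;
  .forLoop 23 11 (
    .ite eligibleExpr (
      .set 28 (.read 13 (.var 23) / truncExpr) ;;
      .ite ((Expr.var 26).eq (.var 11) + (Expr.var 28).lt (.var 25))
        (.set 25 (.var 28) ;; .set 26 (.var 23)) .skip) .skip)

/-- The index `n * L`, which is not a due date, serves as the mark for "none found yet". `hex` rules
it out at the end. -/
theorem wp_ratioProg (hs : I.Small X) (hR : I.Ready m) (hf : I.Fits (m 14))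
    (hex : ∃ q < I.n * I.L, I.Eligible (m 14) (m 22 0) q) :
    WP X O ratioProg (fun m' => m' 26 0 < I.n * I.L ∧ I.Eligible (m 14) (m 22 0) (m' 26 0) ∧
      m' 25 0 = m 13 (m' 26 0) / min (I.p (m' 26 0 / I.L)) (m 21 0) ∧
      ∀ q < I.n * I.L, I.Eligible (m 14) (m 22 0) q →
        m' 25 0 ≤ m 13 q / min (I.p (q / I.L)) (m 21 0)) m := by
  set f := fun q => m 13 q / min (I.p (q / I.L)) (m 21 0) with hfdef
  apply wp_seq
  apply wp_set (by simp)
  apply wp_seq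
  apply wp_set (by simpa [hR.N] using lt_two_pow_of_le hs.N_le)
  apply wp_for (fun k m' =>
      (m' 26 0 = I.n * I.L ∧ ∀ q < k, ¬ I.Eligible (m 14) (m 22 0) q) ∨
      (m' 26 0 < I.n * I.L ∧ I.Eligible (m 14) (m 22 0) (m' 26 0) ∧ m' 25 0 = f (m' 26 0) ∧
        ∀ q < k, I.Eligible (m 14) (m 22 0) q → m' 25 0 ≤ f q)) rfl rfl (by decide)
  · simpa [hR.N] using hs.N_le
  · left; simp [hR.N]
  · intro k m' hk hinv hk' hb hfr
    have hk : k < I.n * I.L := by simpa [hR.N] using hk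
    have hR' : I.Ready m' := hR.congr (hfr 0 (by decide) rfl) (hfr 1 (by decide) rfl)
      (hfr 2 (by decide) rfl) (hfr 8 (by decide) rfl) (hfr 10 (by decide) rfl)
      (hfr 11 (by decide) rfl) (hfr 12 (by decide) rfl)
    have h14 : m' 14 = m 14 := hfr 14 (by decide) rfl
    have h13 : m' 13 = m 13 := hfr 13 (by decide) rfl
    have h21 : m' 21 = m 21 := hfr 21 (by decide) rfl
    have h22 : m' 22 = m 22 := hfr 22 (by decide) rfl
    have hel := eval_eligibleExpr hR' (by rwa [h14]) (by rwa [hk'])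
    have htr := eval_truncExpr hR'
    rw [h14, h22, hk'] at hel
    rw [hk', h21] at htr
    have hrat : (Expr.read 13 (.var 23) / truncExpr).eval m' = f k := by
      rw [Expr.eval_div, htr, Expr.eval_read, Expr.eval_var, hk', h13]
    have hflt : f k < 2 ^ X := (Nat.div_le_self _ _).trans_lt (h13 ▸ hb 13 k)
    have hNlt := hR'.N
    apply wp_ite
    · intro he
      have he : I.Eligible (m 14) (m 22 0) k := by
        by_contra hne; rw [hel, if_neg hne] at he; exact he rfl
      apply wp_seq
      apply wp_set (by rw [hrat]; exact hflt)
      rw [hrat]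
      apply wp_ite
      · intro hc
        have hc : m' 26 0 = I.n * I.L ∨ f k < m' 25 0 := by
          by_contra! hne
          simp [hNlt, hne.1, hne.2] at hc
        apply wp_seq
        apply wp_set (by simpa using hflt)
        apply wp_set (by simpa using hb 23 0)
        right
        simp only [Expr.eval_var, Mem.write_same, Function.update_self, ne_eq,
          Nat.reduceEqDiff, not_false_eq_true, Mem.write_of_ne, hk']
        refine ⟨hk, he, trivial, fun q hq hqe => ?_⟩
        rcases Nat.lt_succ_iff_lt_or_eq.1 hq with h | h
        · rcases hinv with ⟨-, h1⟩ | ⟨h1, -, -, h2⟩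
          · exact absurd hqe (h1 q h)
          · rcases hc with hc | hc
            · omega
            · exact hc.le.trans (h2 q h hqe)
        · rw [h]
      · intro hc
        have hc : m' 26 0 ≠ I.n * I.L ∧ m' 25 0 ≤ f k := by
          by_contra! hne
          by_cases h1 : m' 26 0 = I.n * I.L
          · simp [hNlt, h1] at hc
          · simp [hNlt, h1, hne h1] at hc
        apply wp_skip
        simp only [ne_eq, Nat.reduceEqDiff, not_false_eq_true, Mem.write_of_ne]
        rcases hinv with ⟨h1, -⟩ | ⟨h1, h2, h3, h4⟩
        · exact absurd h1 hc.1
        · refine Or.inr ⟨h1, h2, h3, fun q hq hqe => ?_⟩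
          rcases Nat.lt_succ_iff_lt_or_eq.1 hq with h | h
          · exact h4 q h hqe
          · rw [h]; exact hc.2
    · intro he
      have he : ¬ I.Eligible (m 14) (m 22 0) k := by
        intro h; rw [hel, if_pos h] at he; exact one_ne_zero he
      apply wp_skip
      simp only [ne_eq, Nat.reduceEqDiff, not_false_eq_true, Mem.write_of_ne]
      rcases hinv with ⟨h1, h2⟩ | ⟨h1, h2, h3, h4⟩
      · refine Or.inl ⟨h1, fun q hq hqe => ?_⟩
        rcases Nat.lt_succ_iff_lt_or_eq.1 hq with h | h
        · exact h2 q h hqe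
        · exact he (h ▸ hqe)
      · refine Or.inr ⟨h1, h2, h3, fun q hq hqe => ?_⟩
        rcases Nat.lt_succ_iff_lt_or_eq.1 hq with h | h
        · exact h4 q h hqe
        · exact absurd (h ▸ hqe) he
  · intro m' hinv _
    simp only [Mem.write_of_ne _ _ _ (show (11 : ℕ) ≠ 26 by decide),
      Mem.write_of_ne _ _ _ (show (11 : ℕ) ≠ 25 by decide), hR.N] at hinv
    rcases hinv with ⟨-, h2⟩ | h
    · obtain ⟨q, hq, hqe⟩ := hex
      exact absurd hqe (h2 q hq)
    · exact h

/-- Lower the residual costs. -/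
def updateProg : Prog :=
  .forLoop 23 11 (
    .write 13 (.var 23) (.read 13 (.var 23) - eligibleExpr * (.var 25 * truncExpr)))

theorem wp_updateProg (hs : I.Small X) (hR : I.Ready m) (hf : I.Fits (m 14)) :
    WP X O updateProg (fun m' => ∀ q < I.n * I.L, m' 13 q =
      if I.Eligible (m 14) (m 22 0) q then m 13 q - m 25 0 * min (I.p (q / I.L)) (m 21 0)
      else m 13 q) m := by
  apply wp_for (fun k m' => ∀ q, m' 13 q =
      if q < k ∧ I.Eligible (m 14) (m 22 0) q
      then m 13 q - m 25 0 * min (I.p (q / I.L)) (m 21 0) else m 13 q) rfl rfl (by decide)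
  · simpa [hR.N] using hs.N_le
  · simp
  · intro k m' hk hinv hk' hb hfr
    rw [hR.N] at hk
    have hR' : I.Ready m' := hR.congr (hfr 0 (by decide) rfl) (hfr 1 (by decide) rfl)
      (hfr 2 (by decide) rfl) (hfr 8 (by decide) rfl) (hfr 10 (by decide) rfl)
      (hfr 11 (by decide) rfl) (hfr 12 (by decide) rfl)
    have h14 : m' 14 = m 14 := hfr 14 (by decide) rfl
    have h21 : m' 21 = m 21 := hfr 21 (by decide) rfl
    have h22 : m' 22 = m 22 := hfr 22 (by decide) rfl
    have h25 : m' 25 = m 25 := hfr 25 (by decide) rfl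
    have hel := eval_eligibleExpr hR' (by rwa [h14]) (by rwa [hk'])
    have htr := eval_truncExpr hR'
    rw [h14, h22, hk'] at hel
    rw [hk', h21] at htr
    have h13 : m' 13 k = m 13 k := by rw [hinv, if_neg (by omega)]
    have hv : (Expr.read 13 (.var 23) - eligibleExpr * (.var 25 * truncExpr)).eval m' =
        if I.Eligible (m 14) (m 22 0) k then m 13 k - m 25 0 * min (I.p (k / I.L)) (m 21 0)
        else m 13 k := by
      rw [Expr.eval_sub, Expr.eval_mul, hel, Expr.eval_mul, htr, Expr.eval_read, Expr.eval_var,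
        Expr.eval_var, hk', h25, h13]
      split_ifs <;> simp
    apply wp_write
    · rw [hv]
      have := hb 13 k
      split_ifs <;> omega
    · rw [hv, Expr.eval_var, hk']
      intro q
      rw [Mem.write_of_ne _ _ _ (by decide), Mem.write_same]
      by_cases hq : q = k
      · subst hq; simp
      · rw [Function.update_of_ne hq, hinv]
        have : q < k + 1 ↔ q < k := by omega
        simp only [this]
  · intro m' h _ q hq
    rw [h, hR.N]
    simp [hq]

/-- Record the current due date of the job of the due date `q₁` in array `26` on the stack, and
choose `q₁`. -/
def pushProg : Prog :=
  .write 15 (.var 17) (.var 26 / .var 10) ;;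
  .write 16 (.var 17) (.read 14 (.var 26 / .var 10)) ;;
  .write 14 (.var 26 / .var 10) (.var 26) ;;
  .set 17 (.var 17 + .const 1)

theorem wp_pushProg (hR : I.Ready m) (h17 : m 17 0 + 1 < 2 ^ X) :
    WP X O pushProg (fun m' => m' 15 = Function.update (m 15) (m 17 0) (m 26 0 / I.L) ∧
      m' 16 = Function.update (m 16) (m 17 0) (m 14 (m 26 0 / I.L)) ∧
      m' 14 = Function.update (m 14) (m 26 0 / I.L) (m 26 0) ∧ m' 17 0 = m 17 0 + 1) m := by
  apply WP.of_bounded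
  intro hb
  apply wp_seq
  apply wp_write (by simpa using (Nat.div_le_self _ _).trans_lt (hb 26 0))
  apply wp_seq
  apply wp_write (by simpa using hb 14 _)
  apply wp_seq
  apply wp_write (by simpa using hb 26 0)
  apply wp_set (by simpa using h17)
  simp [hR.L]

/-- Postpone jobs as long as there is a deficit. -/
def forwardProg : Prog :=
  deficitProg ;; .loop (.var 21) (ratioProg ;; updateProg ;; pushProg ;; deficitProg)

/-- The property of the memory maintained by the main loop. -/
structure Partial (I : DueDates) (A : (ℕ → ℕ) → Prop) (m : Mem) : Prop where
  ready : I.Ready m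
  fits : I.Fits (m 14)
  residual : ∀ j < I.n, m 13 (m 14 j) ≤ I.p j
  height : m 17 0 ≤
    ((Finset.range (I.n * I.L)).filter fun q => I.E q ≤ I.E (m 14 (q / I.L))).card
  undo : ∀ ρ, I.Good (m 14) (m 13) ρ → I.Undo (m 15) (m 16) A (m 17 0) ρ
  stack : ∀ i < m 17 0, m 16 i / I.L = m 15 i
  deficit_le : ∀ q < I.n * I.L, I.deficit (m 14) q ≤ m 21 0
  attained : 0 < m 21 0 → ∃ q < I.n * I.L, m 22 0 = I.E q ∧ I.deficit (m 14) q = m 21 0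

theorem wp_body {A : (ℕ → ℕ) → Prop} (hs : I.Small X) (hP : I.Partial A m) (hD : m 21 0 ≠ 0) :
    WP X O (ratioProg ;; updateProg ;; pushProg ;; deficitProg)
      (fun m' => I.Partial A m' ∧ m 17 0 < m' 17 0) m := by
  obtain ⟨q₀, hq₀, he, hdef⟩ := hP.attained (by omega)
  apply wp_seq
  have hex := exists_eligible hq₀ (by rw [hdef]; omega)
  rw [← he] at hex
  refine (wp_ratioProg hs hP.ready hP.fits hex).mono ?_
  rintro m₁ - hfr₁ ⟨hq₁, hel, hrat, hmin⟩
  have hR₁ : I.Ready m₁ := hP.ready.congr (hfr₁ 0 rfl) (hfr₁ 1 rfl) (hfr₁ 2 rfl) (hfr₁ 8 rfl)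
    (hfr₁ 10 rfl) (hfr₁ 11 rfl) (hfr₁ 12 rfl)
  apply wp_seq
  refine (wp_updateProg hs hR₁ (by rw [hfr₁ 14 rfl]; exact hP.fits)).mono ?_
  rintro m₂ - hfr₂ hG
  have hR₂ : I.Ready m₂ := hR₁.congr (hfr₂ 0 rfl) (hfr₂ 1 rfl) (hfr₂ 2 rfl) (hfr₂ 8 rfl)
    (hfr₂ 10 rfl) (hfr₂ 11 rfl) (hfr₂ 12 rfl)
  rw [hfr₁ 13 rfl, hfr₁ 14 rfl, hfr₁ 21 rfl, hfr₁ 22 rfl] at hG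
  -- From here on the registers are an instance of the abstract step, and its analysis applies
  -- however ties were broken.
  have hstep : I.Step (m 14) (m 13) (m 21 0) (m 22 0) (m₁ 25 0) (m₁ 26 0) (m₂ 13) :=
    ⟨by omega, ⟨q₀, hq₀, he, hdef⟩, hP.deficit_le, hq₁, hel, hrat, hmin, hG⟩
  have hcard := hstep.card_lt
  have hle := Finset.card_filter_le (Finset.range (I.n * I.L)) fun q =>
    I.E q ≤ I.E (Function.update (m 14) (m₁ 26 0 / I.L) (m₁ 26 0) (q / I.L))
  rw [Finset.card_range] at hle
  have hN := lt_two_pow_of_le hs.N_le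
  have hht := hP.height
  have h17 : m₂ 17 0 = m 17 0 := by rw [hfr₂ 17 rfl, hfr₁ 17 rfl]
  apply wp_seq
  refine (wp_pushProg hR₂ (by omega)).mono ?_
  rintro m₃ - hfr₃ ⟨h15, h16, h14, h17'⟩
  have hR₃ : I.Ready m₃ := hR₂.congr (hfr₃ 0 rfl) (hfr₃ 1 rfl) (hfr₃ 2 rfl) (hfr₃ 8 rfl)
    (hfr₃ 10 rfl) (hfr₃ 11 rfl) (hfr₃ 12 rfl)
  rw [hfr₂ 14 rfl, hfr₁ 14 rfl, hfr₂ 26 rfl] at h14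
  rw [hfr₂ 15 rfl, hfr₁ 15 rfl, hfr₂ 26 rfl, h17] at h15
  rw [hfr₂ 16 rfl, hfr₁ 16 rfl, hfr₂ 14 rfl, hfr₁ 14 rfl, hfr₂ 26 rfl, h17] at h16
  rw [h17] at h17'
  have hf₃ : I.Fits (m₃ 14) := by rw [h14]; exact hP.fits.update
  refine (wp_deficitProg hs hR₃ hf₃).mono ?_
  rintro m₄ - hfr₄ ⟨hmax, hatt⟩
  rw [← hfr₄ 14 rfl] at hf₃ hmax hatt
  have h14₄ := (hfr₄ 14 rfl).trans h14
  have h17₄ : m₄ 17 0 = m 17 0 + 1 := by rw [hfr₄ 17 rfl, h17']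
  have h13₄ : m₄ 13 = m₂ 13 := by rw [hfr₄ 13 rfl, hfr₃ 13 rfl]
  refine ⟨⟨hR₃.congr (hfr₄ 0 rfl) (hfr₄ 1 rfl) (hfr₄ 2 rfl) (hfr₄ 8 rfl) (hfr₄ 10 rfl)
    (hfr₄ 11 rfl) (hfr₄ 12 rfl), hf₃, ?_, ?_, ?_, ?_, hmax, hatt⟩, by omega⟩
  · intro j hj
    rw [h13₄, h14₄]
    exact hstep.residual_update_le hP.fits hP.residual j hj
  · rw [h14₄, h17₄]; omega
  · intro ρ hρ
    rw [h13₄, h14₄] at hρ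
    rw [hfr₄ 15 rfl, hfr₄ 16 rfl, h15, h16, h17₄, Undo]
    simp only [Function.update_self]
    refine (hP.undo _ (hstep.good_prune hP.fits hP.residual hρ)).congr ?_ ?_
    · intro k hk; rw [Function.update_of_ne hk.ne]
    · intro k hk; rw [Function.update_of_ne hk.ne]
  · intro i hi
    rw [hfr₄ 15 rfl, hfr₄ 16 rfl, h15, h16]
    rcases Nat.lt_succ_iff_lt_or_eq.1 (h17₄ ▸ hi) with h | h
    · rw [Function.update_of_ne h.ne, Function.update_of_ne h.ne, hP.stack i h]
    · rw [h, Function.update_self, Function.update_self, hP.fits _ hstep.job_lt]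

/-- After the main loop, undoing the recorded steps leads to a good assignment. -/
theorem wp_forwardProg (hs : I.Small X) (hR : I.Ready m) (hf : I.Fits (m 14))
    (hG : ∀ j < I.n, m 13 (m 14 j) = 0) (h17 : m 17 0 = 0) :
    WP X O forwardProg (fun m' => I.Ready m' ∧ I.Fits (m' 14) ∧ m' 17 0 ≤ I.n * I.L ∧
      (∀ i < m' 17 0, m' 16 i / I.L = m' 15 i) ∧
      I.Undo (m' 15) (m' 16) (I.Good (m 14) (m 13)) (m' 17 0) (m' 14)) m := by
  apply wp_seq
  refine (wp_deficitProg hs hR hf).mono ?_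
  rintro m₁ - hfr₁ ⟨hmax, hatt⟩
  have hcard : ∀ ρ : ℕ → ℕ,
      ((Finset.range (I.n * I.L)).filter fun q => I.E q ≤ I.E (ρ (q / I.L))).card ≤
        I.n * I.L := fun ρ => by
    simpa using Finset.card_filter_le (Finset.range (I.n * I.L)) fun q => I.E q ≤ I.E (ρ (q / I.L))
  -- Each iteration pushes one entry, and the height never exceeds the number of due dates not later
  -- than the chosen ones, so at most `n * L` iterations occur.
  apply wp_loop (I.Partial (I.Good (m 14) (m 13))) (fun m' => I.n * I.L - m' 17 0)
  · refine ⟨hR.congr (hfr₁ 0 rfl) (hfr₁ 1 rfl) (hfr₁ 2 rfl) (hfr₁ 8 rfl) (hfr₁ 10 rfl)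
      (hfr₁ 11 rfl) (hfr₁ 12 rfl), by rwa [hfr₁ 14 rfl], ?_, ?_, ?_, ?_, ?_, ?_⟩
    · intro j hj; rw [hfr₁ 14 rfl, hfr₁ 13 rfl, hG j hj]; exact Nat.zero_le _
    · rw [hfr₁ 17 rfl, h17]; exact Nat.zero_le _
    · intro ρ hρ; rwa [hfr₁ 17 rfl, h17, Undo, ← hfr₁ 14 rfl, ← hfr₁ 13 rfl]
    · rw [hfr₁ 17 rfl, h17]; intro i hi; omega
    · rwa [hfr₁ 14 rfl]
    · rwa [hfr₁ 14 rfl]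
  · exact (Nat.sub_le _ _).trans hs.N_le
  · intro m' hP hD _
    refine (wp_body hs hP hD).mono ?_
    rintro m'' - - ⟨hP', hlt⟩
    have := hP'.height
    have := hcard (m'' 14)
    exact ⟨hP', by omega⟩
  · intro m' hP hD _
    refine ⟨hP.ready, hP.fits, hP.height.trans (hcard _), hP.stack, hP.undo _ ?_⟩
    refine good_self hP.fits hP.residual fun q hq => ?_
    have := hP.deficit_le q hq
    rw [Expr.eval_var] at hD
    omega

/-- Undo the steps recorded on the stack, in reverse order, if this keeps the assignment
feasible. -/
def backwardProg : Prog :=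
  .loop (.var 17) (
    .set 17 (.var 17 - .const 1) ;;
    .set 29 (.read 14 (.read 15 (.var 17))) ;;
    .write 14 (.read 15 (.var 17)) (.read 16 (.var 17)) ;;
    deficitProg ;;
    .ite (.var 21) (.write 14 (.read 15 (.var 17)) (.var 29)) .skip)

theorem wp_backwardProg {A : (ℕ → ℕ) → Prop} (hs : I.Small X) (hR : I.Ready m)
    (hf : I.Fits (m 14)) (h17 : m 17 0 ≤ I.n * I.L)
    (hst : ∀ i < m 17 0, m 16 i / I.L = m 15 i)
    (hU : I.Undo (m 15) (m 16) A (m 17 0) (m 14)) :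
    WP X O backwardProg (fun m' => A (m' 14)) m := by
  apply wp_loop (fun m' => I.Fits (m' 14) ∧ m' 17 0 ≤ m 17 0 ∧
    I.Undo (m 15) (m 16) A (m' 17 0) (m' 14)) (fun m' => m' 17 0)
  · exact ⟨hf, le_rfl, hU⟩
  · exact h17.trans hs.N_le
  · rintro m' ⟨hf', hle, hU'⟩ h0 hfr
    rw [Expr.eval_var] at h0
    obtain ⟨i, hi⟩ := Nat.exists_eq_succ_of_ne_zero h0
    have hR' : I.Ready m' := hR.congr (hfr 0 rfl) (hfr 1 rfl) (hfr 2 rfl) (hfr 8 rfl)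
      (hfr 10 rfl) (hfr 11 rfl) (hfr 12 rfl)
    have h15 : m' 15 = m 15 := hfr 15 rfl
    have h16 : m' 16 = m 16 := hfr 16 rfl
    have hfit := hst i (by omega)
    rw [hi, Undo, prune] at hU'
    set k := m 15 i with hk
    set v := m 16 i with hv
    apply WP.of_bounded
    intro hb
    apply wp_seq
    apply wp_set (by have := hb 17 0; rw [Expr.eval_sub, Expr.eval_var]; omega)
    have hi' : (Expr.var 17 - .const 1).eval m' = i := by simp [hi]
    rw [hi']
    apply wp_seq
    apply wp_set (by simpa using hb 14 _)
    apply wp_seq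
    apply wp_write (by simpa using hb 16 _)
    simp only [Expr.eval_read, Expr.eval_var, Mem.write_same, Function.update_self, ne_eq,
      Nat.reduceEqDiff, not_false_eq_true, Mem.write_of_ne, h15, h16, ← hk, ← hv]
    have hf₁ : I.Fits (Function.update (m' 14) k v) := by
      rw [← hfit]; exact hf'.update
    apply wp_seq
    refine (wp_deficitProg hs (hR'.congr ?_ ?_ ?_ ?_ ?_ ?_ ?_) ?_).mono ?_
    iterate 7 simp
    · simpa using hf₁
    rintro m₁ - hfr₁ ⟨hmax, hatt⟩
    simp only [Mem.write_same, ne_eq, Nat.reduceEqDiff, not_false_eq_true, Mem.write_of_ne]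
      at hmax hatt
    have h14₁ : m₁ 14 = Function.update (m' 14) k v := by simp [hfr₁ 14 rfl]
    have h15₁ : m₁ 15 = m 15 := by simp [hfr₁ 15 rfl, h15]
    have h17₁ : m₁ 17 0 = i := by simp [hfr₁ 17 rfl]
    have h29₁ : m₁ 29 0 = m' 14 k := by simp [hfr₁ 29 rfl]
    apply wp_ite
    · intro hD
      rw [Expr.eval_var] at hD
      obtain ⟨q, hq, -, hdef⟩ := hatt (by omega)
      -- A nonzero maximum is an actual deficit, so `prune` keeps the old choice and the saved due
      -- date is restored.
      have hnf : ¬ I.Feas (Function.update (m' 14) k v) := fun h => hD (hdef ▸ h q hq)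
      rw [if_neg hnf] at hU'
      apply wp_write
      · rw [Expr.eval_var, h29₁]; exact hb 14 _
      · simp only [Expr.eval_read, Expr.eval_var, Mem.write_same, ne_eq, Nat.reduceEqDiff,
          not_false_eq_true, Mem.write_of_ne, h14₁, h15₁, h17₁, h29₁, ← hk, Function.update_idem,
          Function.update_eq_self]
        exact ⟨⟨hf', by omega, hU'⟩, by omega⟩
    · intro hD
      rw [Expr.eval_var] at hD
      have hF : I.Feas (Function.update (m' 14) k v) := fun q hq => by
        have := hmax q hq; omega
      rw [if_pos hF] at hU'
      apply wp_skip
      rw [h14₁, h17₁]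
      exact ⟨⟨hf₁, by omega, hU'⟩, by omega⟩
  · rintro m' ⟨-, -, hU'⟩ h0 -
    rw [Expr.eval_var] at h0
    rwa [h0, Undo] at hU'

end DueDates

/-! ### The algorithm -/

namespace GSP

open RAM

/-- Bounds for all numbers that occur when the algorithm runs on the instance. -/
structure Bounds (I : GSP) (B X : ℕ) : Prop where
  n_le : I.n ≤ X
  N_le : I.n * (B + 1) ≤ X
  B_lt : B < X
  mul_lt : (I.horizon + 1) * 2 ^ B < 2 ^ X
  lt_of_ne_zero : ∀ j k, I.doublingTime j k ≠ 0 → k < B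

variable {I : GSP} {B X : ℕ} {m : Mem}

theorem Bounds.horizon_lt (h : I.Bounds B X) : I.horizon < 2 ^ X := by
  have := h.mul_lt
  have : 1 ≤ 2 ^ B := Nat.one_le_two_pow
  nlinarith

theorem Bounds.doublingTime_lt (h : I.Bounds B X) (j k : ℕ) : I.doublingTime j k < 2 ^ X :=
  (doublingTime_le_horizon j k).trans_lt h.horizon_lt

/-- Find a level that exceeds the costs of all jobs. -/
def levelProg : Prog :=
  .set 9 (.const 0) ;;
  .forLoop 18 0 (
    .query 19 (.const 0) (.var 18) (.var 9) ;;
    .loop (.var 19) (.set 9 (.var 9 + .const 1) ;; .query 19 (.const 0) (.var 18) (.var 9)))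

/-- The level is never reset between jobs: by `doublingTime_anti`, raising it preserves the absence
of answers for earlier jobs. It rises only after a genuine answer, which forces it to be below `B`.
-/
theorem wp_levelProg (hB : I.Bounds B X) (hn : m 0 0 = I.n) :
    WP X I.doublingTime levelProg
      (fun m' => m' 9 0 ≤ B ∧ ∀ j < I.n, I.doublingTime j (m' 9 0) = 0) m := by
  apply wp_seq
  apply wp_set (by simp)
  apply wp_for (fun k m' => m' 9 0 ≤ B ∧ ∀ j < k, I.doublingTime j (m' 9 0) = 0)
    rfl rfl (by decide)
  · simpa [hn] using hB.n_le
  · simp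
  · rintro k m' - ⟨h1, h2⟩ hk' - -
    apply wp_seq
    apply wp_query (by exact hB.doublingTime_lt _ _)
    apply wp_loop (fun m₁ => m₁ 9 0 ≤ B ∧ (∀ j < k, I.doublingTime j (m₁ 9 0) = 0) ∧
      m₁ 19 0 = I.doublingTime k (m₁ 9 0)) (fun m₁ => B - m₁ 9 0)
    · simp [h1, hk']
      exact h2
    · have := hB.B_lt; omega
    · rintro m₁ ⟨h3, h4, h5⟩ hne hfr
      have h18 : m₁ 18 0 = k := by rw [hfr 18 rfl]; simp [hk']
      rw [Expr.eval_var, h5] at hne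
      have hlt := hB.lt_of_ne_zero _ _ hne
      have hBX := hB.B_lt
      apply wp_seq
      apply wp_set (by simpa using lt_two_pow_of_le (by omega))
      apply wp_query (by exact hB.doublingTime_lt _ _)
      simp only [Expr.eval_var, Expr.eval_const, Expr.eval_add, Mem.write_same,
        Function.update_self, ne_eq, Nat.reduceEqDiff, not_false_eq_true, Mem.write_of_ne, h18]
      exact ⟨⟨by omega, fun j hj => doublingTime_anti (Nat.le_succ _) (h4 j hj), trivial⟩,
        by omega⟩
    · rintro m₁ ⟨h3, h4, h5⟩ h0 -
      rw [Expr.eval_var, h5] at h0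
      simp only [ne_eq, Nat.reduceEqDiff, not_false_eq_true, Mem.write_of_ne]
      refine ⟨h3, fun j hj => ?_⟩
      rcases Nat.lt_succ_iff_lt_or_eq.1 hj with h | h
      · exact h4 j h
      · rw [h]; exact h0
  · rintro m' h _
    simpa [hn] using h

/-- The level of the due date with the index in array `23`. -/
def levelExpr : Expr := .var 23 - .var 23 / .var 10 * .var 10

/-- Tabulate the due dates and their costs. -/
def tableProg : Prog :=
  .forLoop 23 11 (
    .query 19 (.const 0) (.var 23 / .var 10) levelExpr ;;
    .write 12 (.var 23) ((Expr.var 19).eq (.const 0) * .var 8 + (.var 19 - .const 1)) ;;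
    .write 13 (.var 23) (levelExpr.eq (.const 1) * (.var 7 + .const 1) +
      (Expr.const 1).lt levelExpr * (.const 2 * .read 13 (.var 23 - .const 1))))

theorem levelCost_succ (l : ℕ) (hl : 0 < l) : levelCost (l + 1) = 2 * levelCost l := by
  unfold levelCost
  rw [if_neg (by omega), if_neg (by omega), ← pow_succ']
  congr 1
  omega

theorem levelCost_le (l : ℕ) : levelCost l ≤ 2 ^ l := by
  unfold levelCost
  split_ifs
  · exact Nat.zero_le _
  · exact Nat.pow_le_pow_right (by norm_num) (Nat.sub_le _ _)

theorem wp_tableProg (hB : I.Bounds B X) {K : ℕ} (hKB : K ≤ B) (h8 : m 8 0 = I.horizon)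
    (h7 : m 7 0 ≤ I.horizon) (h10 : m 10 0 = K + 1) (h11 : m 11 0 = I.n * (K + 1)) :
    WP X I.doublingTime tableProg (fun m' => ∀ q < I.n * (K + 1),
      m' 12 q = I.dueDate (q / (K + 1)) (q % (K + 1)) ∧
      m' 13 q = (m 7 0 + 1) * levelCost (q % (K + 1))) m := by
  apply wp_for (fun k m' => ∀ q < k,
      m' 12 q = I.dueDate (q / (K + 1)) (q % (K + 1)) ∧
      m' 13 q = (m 7 0 + 1) * levelCost (q % (K + 1))) rfl rfl (by decide)
  · rw [h11]
    exact le_trans (Nat.mul_le_mul_left _ (by omega)) hB.N_le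
  · intro q hq; omega
  · intro k m' hk hinv hk' hb hfr
    have h7' : m' 7 0 = m 7 0 := by rw [hfr 7 (by decide) rfl]
    have h8' : m' 8 0 = I.horizon := by rw [hfr 8 (by decide) rfl, h8]
    have h10' : m' 10 0 = K + 1 := by rw [hfr 10 (by decide) rfl, h10]
    have hmod : k - k / (K + 1) * (K + 1) = k % (K + 1) := by
      have := Nat.div_add_mod' k (K + 1)
      omega
    have hmodK : k % (K + 1) ≤ K := Nat.lt_succ_iff.1 (Nat.mod_lt _ K.succ_pos)
    apply wp_seq
    apply wp_query (by exact hB.doublingTime_lt _ _)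
    simp only [levelExpr, Expr.eval_var, Expr.eval_const, Expr.eval_sub, Expr.eval_mul,
      Expr.eval_div, hk', h10', hmod]
    -- For the answer `0`, truncated subtraction kills the second summand and the horizon remains.
    have hdue : (if I.doublingTime (k / (K + 1)) (k % (K + 1)) = 0 then 1 else 0) * I.horizon +
        (I.doublingTime (k / (K + 1)) (k % (K + 1)) - 1) =
        I.dueDate (k / (K + 1)) (k % (K + 1)) := by
      unfold dueDate
      split_ifs with h
      · simp [h]
      · simp
    -- Powers of two arise by doubling the previous entry, which above level 1 belongs to the same
    -- job, one level lower.
    have hcost : (if k % (K + 1) = 1 then 1 else 0) * (m 7 0 + 1) +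
        (if 1 < k % (K + 1) then 1 else 0) * (2 * m' 13 (k - 1)) =
        (m 7 0 + 1) * levelCost (k % (K + 1)) := by
      rcases Nat.lt_trichotomy (k % (K + 1)) 1 with h | h | h
      · simp [show k % (K + 1) = 0 by omega, levelCost]
      · simp [h, levelCost]
      · have hk0 : 0 < k := by
          rcases Nat.eq_zero_or_pos k with h0 | h0
          · simp [h0] at h
          · exact h0
        have hpred : (k - 1) % (K + 1) = k % (K + 1) - 1 := by
          have h1 := Nat.div_add_mod' k (K + 1)
          rw [show k - 1 = (k % (K + 1) - 1) + k / (K + 1) * (K + 1) by omega,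
            Nat.add_mul_mod_self_right, Nat.mod_eq_of_lt (by omega)]
        obtain ⟨l, hl⟩ : ∃ l, k % (K + 1) = l + 1 := ⟨k % (K + 1) - 1, by omega⟩
        rw [if_neg (by omega), if_pos h, (hinv (k - 1) (by omega)).2, hpred, hl,
          Nat.add_sub_cancel, levelCost_succ l (by omega)]
        ring
    apply wp_seq
    apply wp_write
    · simp only [Expr.eval_add, Expr.eval_mul, Expr.eval_eq, Expr.eval_sub, Expr.eval_const,
        Expr.eval_var, Mem.write_same, Function.update_self, ne_eq, Nat.reduceEqDiff,
        not_false_eq_true, Mem.write_of_ne, h8', hdue]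
      exact (dueDate_le_horizon _ _).trans_lt hB.horizon_lt
    simp only [Expr.eval_add, Expr.eval_mul, Expr.eval_eq, Expr.eval_sub, Expr.eval_const,
      Expr.eval_var, Mem.write_same, Function.update_self, ne_eq, Nat.reduceEqDiff,
      not_false_eq_true, Mem.write_of_ne, h8', hdue, hk']
    apply wp_write
    · simp only [Expr.eval_add, Expr.eval_mul, Expr.eval_eq, Expr.eval_sub, Expr.eval_const,
        Expr.eval_var, Expr.eval_div, Expr.eval_lt, Expr.eval_read, ne_eq, Nat.reduceEqDiff,
        not_false_eq_true, Mem.write_of_ne, h7', h10', hk', hmod, hcost]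
      refine lt_of_le_of_lt (Nat.mul_le_mul (Nat.succ_le_succ h7) ((levelCost_le _).trans
        (Nat.pow_le_pow_right (by norm_num) (hmodK.trans hKB)))) hB.mul_lt
    · simp only [Expr.eval_add, Expr.eval_mul, Expr.eval_eq, Expr.eval_sub, Expr.eval_const,
        Expr.eval_var, Expr.eval_div, Expr.eval_lt, Expr.eval_read, ne_eq, Nat.reduceEqDiff,
        not_false_eq_true, Mem.write_of_ne, Mem.write_same, h7', h10', hk', hmod, hcost]
      intro q hq
      rcases Nat.lt_succ_iff_lt_or_eq.1 hq with h | h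
      · rw [Function.update_of_ne h.ne, Function.update_of_ne h.ne]
        exact hinv q h
      · subst h; simp
  · intro m' h _
    rwa [h11] at h

/-- Choose the first due date for each job. -/
def choiceProg : Prog := .forLoop 18 0 (.write 14 (.var 18) (.var 18 * .var 10))

theorem wp_choiceProg (hB : I.Bounds B X) {K : ℕ} (hKB : K ≤ B) (h0 : m 0 0 = I.n)
    (h10 : m 10 0 = K + 1) :
    WP X I.doublingTime choiceProg (fun m' => ∀ j < I.n, m' 14 j = j * (K + 1)) m := by
  apply wp_for (fun k m' => ∀ j < k, m' 14 j = j * (K + 1)) rfl rfl (by decide)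
  · rw [h0]; exact hB.n_le
  · intro q hq; omega
  · intro k m' hk hinv hk' hb hfr
    have h10' : m' 10 0 = K + 1 := by rw [hfr 10 (by decide) rfl, h10]
    have hv : (Expr.var 18 * .var 10).eval m' = k * (K + 1) := by simp [hk', h10']
    apply wp_write
    · rw [hv]
      refine lt_two_pow_of_le (le_trans (Nat.mul_le_mul ?_ ?_) hB.N_le) <;> omega
    · rw [hv, Expr.eval_var, hk', Mem.write_of_ne _ _ _ (by decide), Mem.write_same]
      intro j hj
      rcases Nat.lt_succ_iff_lt_or_eq.1 hj with h | h
      · rw [Function.update_of_ne h.ne]; exact hinv j h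
      · subst h; simp
  · intro m' h _
    rwa [h0] at h

/-- Set up the due date problem. -/
def initProg : Prog :=
  .sumLoop 7 24 0 (.read 2 (.var 24)) ;;
  .set 8 (.var 1 + .var 7) ;;
  levelProg ;;
  .set 10 (.var 9 + .const 1) ;;
  .set 11 (.var 0 * .var 10) ;;
  tableProg ;;
  choiceProg

theorem wp_initProg (hr : ∀ i j, I.r i = I.r j) (hB : I.Bounds B X) :
    WP X I.doublingTime initProg (fun m => ∃ K ≤ B, ∃ hK : ∀ j < I.n, I.doublingTime j K = 0,
      (dueDates hr K hK).Ready m ∧ (∀ q < I.n * (K + 1), m 13 q =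
        (∑ j ∈ Finset.range I.n, I.size j + 1) * levelCost (q % (K + 1))) ∧
      (∀ j < I.n, m 14 j = j * (K + 1)) ∧ m 17 0 = 0) I.inputMem := by
  have hh := horizon_eq hr
  have hlt := hB.horizon_lt
  have hn : I.inputMem 0 0 = I.n := by simp [inputMem]
  apply wp_seq
  apply wp_sumLoop I.size (by decide) (by decide) (by decide) (hn.trans_le hB.n_le)
  · intro k _ m' hk hfr
    rw [Expr.eval_read, Expr.eval_var, hk, hfr 2 (by decide) (by decide)]; rfl
  · rw [hn]; omega
  intro m₁ h7 hfr₁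
  rw [hn] at h7
  have h1₁ : m₁ 1 0 = I.release := by rw [hfr₁ 1 (by decide) (by decide)]; rfl
  have hv : (Expr.var 1 + .var 7).eval m₁ = I.horizon := by simp [h1₁, h7, hh]
  apply wp_seq
  apply wp_set (by rw [hv]; exact hlt)
  rw [hv]
  apply wp_seq
  refine (wp_levelProg hB ?_).mono ?_
  · simp [hfr₁ 0, hn]
  rintro m₂ - hfr₂ ⟨hKB, hK⟩
  set K := m₂ 9 0 with hKdef
  have hBX := hB.B_lt
  apply wp_seq
  apply wp_set (by simpa using lt_two_pow_of_le (by omega))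
  have h0₂ : m₂ 0 0 = I.n := by simp [hfr₂ 0 rfl, hfr₁ 0, hn]
  apply wp_seq
  apply wp_set
  · simp only [Expr.eval_mul, Expr.eval_var, Expr.eval_add, Expr.eval_const, Mem.write_same,
      Function.update_self, ne_eq, not_false_eq_true, Mem.write_of_ne, OfNat.zero_ne_ofNat, h0₂]
    exact lt_two_pow_of_le ((Nat.mul_le_mul_left _ (by omega)).trans hB.N_le)
  simp only [Expr.eval_mul, Expr.eval_var, Expr.eval_add, Expr.eval_const, Mem.write_same,
      Function.update_self, ne_eq, not_false_eq_true, Mem.write_of_ne, OfNat.zero_ne_ofNat,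
      h0₂, ← hKdef]
  have h7₂ : m₂ 7 0 = ∑ j ∈ Finset.range I.n, I.size j := by simp [hfr₂ 7 rfl, h7]
  apply wp_seq
  refine (wp_tableProg hB hKB ?_ ?_ ?_ ?_).mono ?_
  · simp [hfr₂ 8 rfl]
  · simp [h7₂, hh]
  · simp
  · simp
  intro m₃ _ hfr₃ hT
  simp only [ne_eq, Nat.reduceEqDiff, not_false_eq_true, Mem.write_of_ne, h7₂] at hT
  refine (wp_choiceProg hB hKB ?_ ?_).mono ?_
  · simp [hfr₃ 0 rfl, h0₂]
  · simp [hfr₃ 10 rfl]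
  intro m₄ _ hfr₄ hC
  refine ⟨K, hKB, hK, ⟨?_, ?_, ?_, ?_, ?_, ?_, ?_⟩, ?_, hC, ?_⟩
  · simp [hfr₄ 0 rfl, hfr₃ 0 rfl, h0₂, dueDates]
  · simp [hfr₄ 1 rfl, hfr₃ 1 rfl, hfr₂ 1 rfl, h1₁, dueDates]
  · simp [hfr₄ 2 rfl, hfr₃ 2 rfl, hfr₂ 2 rfl, hfr₁ 2, dueDates]
    rfl
  · simp [hfr₄ 8 rfl, hfr₃ 8 rfl, hfr₂ 8 rfl, dueDates_H]
  · simp [hfr₄ 10 rfl, hfr₃ 10 rfl, dueDates]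
  · simp [hfr₄ 11 rfl, hfr₃ 11 rfl, dueDates]
  · intro q hq
    rw [hfr₄ 12 rfl]
    exact (hT q hq).1
  · intro q hq
    rw [hfr₄ 13 rfl]
    exact (hT q hq).2
  · simp [hfr₄ 17 rfl, hfr₃ 17 rfl, hfr₂ 17 rfl, hfr₁ 17, inputMem]

/-- Output the schedule that processes the jobs in the order of their due dates. -/
def outputProg : Prog :=
  .set 3 (.var 0) ;;
  .forLoop 18 0 (
    .set 27 (.read 12 (.read 14 (.var 18))) ;;
    .sumLoop 20 24 0 (((Expr.read 12 (.read 14 (.var 24))).lt (.var 27) +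
      (Expr.read 12 (.read 14 (.var 24))).eq (.var 27) * (Expr.var 24).lt (.var 18)) *
        .read 2 (.var 24)) ;;
    .write 4 (.var 18) (.var 18) ;;
    .write 5 (.var 18) (.var 1 + .var 20) ;;
    .write 6 (.var 18) (.read 5 (.var 18) + .read 2 (.var 18)))

theorem wp_outputProg (hr : ∀ i j, I.r i = I.r j) (hB : I.Bounds B X) {K : ℕ}
    (hK : ∀ j < I.n, I.doublingTime j K = 0) (hR : (dueDates hr K hK).Ready m)
    (hf : (dueDates hr K hK).Fits (m 14)) (hF : (dueDates hr K hK).Feas (m 14)) :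
    WP X I.doublingTime outputProg
      (fun m' => I.Describes m'
        (I.orderedSchedule fun l => (dueDates hr K hK).E (m 14 l))) m := by
  set D := dueDates hr K hK with hD
  set d := fun l => D.E (m 14 l) with hd
  have hn : m 0 0 = I.n := hR.n
  have hend : ∀ j < I.n, I.startTime d j + I.size j ≤ I.horizon := fun j hj =>
    (startTime_add_le_dueDate hr hK hf hF hj).trans (dueDate_le_horizon _ _)
  have hlt := hB.horizon_lt
  apply wp_seq
  apply wp_set (by rw [Expr.eval_var, hn]; exact lt_two_pow_of_le hB.n_le)
  rw [Expr.eval_var, hn]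
  apply wp_for (fun k m' => ∀ j < k, m' 4 j = j ∧ m' 5 j = I.startTime d j ∧
    m' 6 j = I.startTime d j + I.size j) rfl rfl (by decide)
  · simpa [hn] using hB.n_le
  · intro q hq; omega
  · intro k m' hk hinv hk' hb hfr
    have hk : k < I.n := by simpa [hn] using hk
    have hR' : D.Ready m' := hR.congr (hfr 0 (by decide) rfl) (hfr 1 (by decide) rfl)
      (hfr 2 (by decide) rfl) (hfr 8 (by decide) rfl) (hfr 10 (by decide) rfl)
      (hfr 11 (by decide) rfl) (hfr 12 (by decide) rfl)
    have h14 : m' 14 = m 14 := hfr 14 (by decide) rfl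
    have hE : ∀ j < I.n, m' 12 (m' 14 j) = d j := fun j hj => by
      rw [h14]; exact hR'.E _ (hf.lt hj)
    have hp : m' 2 = I.size := hR'.p
    have hn' : m' 0 0 = I.n := hR'.n
    have hr' : m' 1 0 = I.release := hR'.r
    have hlast := hend k hk
    apply wp_seq
    apply wp_set (hb _ _)
    simp only [Expr.eval_read, Expr.eval_var, hk', hE k hk]
    apply wp_seq
    apply wp_sumLoop (fun l => if Before d l k then I.size l else 0) (by decide) (by decide)
      (by decide)
    · simpa [hn'] using hB.n_le
    · intro l hl m₁ hl₁ hfr₁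
      have hl : l < I.n := by simpa [hn'] using hl
      simp only [Expr.eval_add, Expr.eval_mul, Expr.eval_lt, Expr.eval_eq, Expr.eval_read,
        Expr.eval_var, hl₁, hfr₁ 12 (by decide) (by decide), hfr₁ 14 (by decide) (by decide),
        hfr₁ 27 (by decide) (by decide), hfr₁ 18 (by decide) (by decide),
        hfr₁ 2 (by decide) (by decide), ne_eq, Nat.reduceEqDiff, not_false_eq_true,
        Mem.write_of_ne, Mem.write_same, Function.update_self, hE l hl, hp, hk']
      by_cases hbf : Before d l k
      · rw [if_pos hbf]
        unfold Before at hbf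
        split_ifs <;> omega
      · rw [if_neg hbf]
        unfold Before at hbf
        split_ifs <;> omega
    · rw [Mem.write_of_ne _ _ _ (by decide), hn']
      unfold startTime at hlast
      omega
    intro m₁ hsum hfr₁
    rw [Mem.write_of_ne _ _ _ (by decide), hn'] at hsum
    have hfr₂ : ∀ a, a ≠ 24 → a ≠ 20 → a ≠ 27 → m₁ a = m' a := fun a h1 h2 h3 => by
      rw [hfr₁ a h1 h2, Mem.write_of_ne _ _ _ h3]
    have h18 : m₁ 18 0 = k := by rw [hfr₂ 18 (by decide) (by decide) (by decide), hk']
    have hst : m₁ 1 0 + m₁ 20 0 = I.startTime d k := by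
      rw [hfr₂ 1 (by decide) (by decide) (by decide), hr', hsum]; rfl
    apply wp_seq
    apply wp_write (by simpa [h18] using lt_two_pow_of_le (by have := hB.n_le; omega))
    simp only [Expr.eval_var, h18]
    apply wp_seq
    apply wp_write
    · simp [hst]; omega
    simp only [Expr.eval_var, Expr.eval_add, ne_eq, Nat.reduceEqDiff, not_false_eq_true,
      OfNat.one_ne_ofNat, Mem.write_of_ne, h18, hst]
    have hv : (Expr.read 5 (.var 18) + .read 2 (.var 18)).eval
        ((m₁.write 4 k k).write 5 k (I.startTime d k)) = I.startTime d k + I.size k := by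
      simp [h18, hfr₂ 2, hp]
    apply wp_write
    · rw [hv]; omega
    rw [hv]
    simp only [Expr.eval_var, ne_eq, Nat.reduceEqDiff, not_false_eq_true,
      Mem.write_of_ne, Mem.write_same, h18, hfr₂ 4 (by decide) (by decide) (by decide),
      hfr₂ 5 (by decide) (by decide) (by decide), hfr₂ 6 (by decide) (by decide) (by decide)]
    intro j hj
    rcases Nat.lt_succ_iff_lt_or_eq.1 hj with h | h
    · rw [Function.update_of_ne h.ne, Function.update_of_ne h.ne, Function.update_of_ne h.ne]
      exact hinv j h
    · subst h; simp
  · intro m' hinv hfr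
    have h0 : (m.write 3 0 I.n) 0 0 = I.n := by simp [hn]
    rw [h0] at hinv
    have h3 : m' 3 0 = I.n := by rw [hfr 3 (by decide) rfl]; simp
    intro s j
    rw [h3]
    constructor
    · rintro ⟨hj, hs⟩
      rw [orderedSchedule_eq_some] at hs
      obtain ⟨h4, h5, h6⟩ := hinv j hj
      exact ⟨j, hj, h4, by rw [h5]; exact hs.1, by rw [h6]; exact hs.2⟩
    · rintro ⟨i, hi, rfl, hs1, hs2⟩
      obtain ⟨h4, h5, h6⟩ := hinv i hi
      rw [h5] at hs1
      rw [h6] at hs2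
      refine ⟨by rwa [h4], ?_⟩
      rw [orderedSchedule_eq_some]
      simp only [h4]
      exact ⟨hs1, hs2⟩

/-- The approximation algorithm. -/
def approxProg : Prog :=
  initProg ;; DueDates.forwardProg ;; DueDates.backwardProg ;; outputProg

theorem wp_approxProg (hr : ∀ i j, I.r i = I.r j) (hB : I.Bounds B X) :
    WP X I.doublingTime approxProg (fun m => ∃ σ, I.Describes m σ ∧ I.Feasible σ ∧
      ∀ σ', I.Feasible σ' → I.cost σ ≤ 8 * I.cost σ') I.inputMem := by
  apply wp_seq
  refine (wp_initProg hr hB).mono ?_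
  rintro m₁ - - ⟨K, hKB, hK, hR₁, hG, hC, h17⟩
  have hs : (dueDates hr K hK).Small X :=
    ⟨hB.n_le, (Nat.mul_le_mul_left _ (Nat.succ_le_succ hKB)).trans hB.N_le,
      (dueDates_H hr hK).trans_lt hB.horizon_lt⟩
  have hf₁ : (dueDates hr K hK).Fits (m₁ 14) := fun j hj => by
    rw [hC j hj]; exact Nat.mul_div_cancel _ K.succ_pos
  apply wp_seq
  refine (DueDates.wp_forwardProg hs hR₁ hf₁ (fun j hj => ?_) h17).mono ?_
  · rw [hG _ (hf₁.lt hj), hC j hj, Nat.mul_mod_left]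
    simp [levelCost]
  rintro m₂ - - ⟨hR₂, hf₂, hht, hst, hU⟩
  apply wp_seq
  refine (DueDates.wp_backwardProg hs hR₂ hf₂ hht hst hU).mono ?_
  intro m₃ _ hfr₃ hgood
  refine (wp_outputProg hr hB hK (hR₂.congr (hfr₃ 0 rfl) (hfr₃ 1 rfl) (hfr₃ 2 rfl) (hfr₃ 8 rfl)
    (hfr₃ 10 rfl) (hfr₃ 11 rfl) (hfr₃ 12 rfl)) hgood.fits hgood.feas).mono ?_
  intro m₄ _ _ hdesc
  exact ⟨_, hdesc, feasible_orderedSchedule hr _,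
    fun σ' hσ' => cost_orderedSchedule_le hr hK hgood hG hσ'⟩

/-- The measure of the size of an instance. -/
def inputSize (I : GSP) : ℕ :=
  I.n + Nat.size I.maxRelease + Nat.size I.maxSize + Nat.size I.maxWeight

theorem horizon_lt_two_pow (I : GSP) : I.horizon < 2 ^ (2 * I.inputSize + 1) := by
  have h1 : I.maxRelease < 2 ^ I.inputSize := Nat.size_le.1 (by unfold inputSize; omega)
  have h2 : I.maxSize < 2 ^ I.inputSize := Nat.size_le.1 (by unfold inputSize; omega)
  have h3 : I.n < 2 ^ I.inputSize := lt_two_pow_of_le (by unfold inputSize; omega)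
  have h4 : ∑ j, I.p j ≤ I.n * I.maxSize := by
    simpa using Finset.sum_le_card_nsmul Finset.univ I.p I.maxSize
      fun j _ => Finset.le_sup (Finset.mem_univ j)
  have h5 : (2 : ℕ) ^ (2 * I.inputSize + 1) = 2 * (2 ^ I.inputSize * 2 ^ I.inputSize) := by ring
  unfold horizon
  rw [h5]
  nlinarith

/-- With `s` the input size, an answered level has `2 ^ k ≤ W * T < 2 ^ s * 2 ^ (2 * s + 1)`, whence
`B = 3 * s + 1`. The scaled costs stay below `2 ^ (5 * s + 3)`, and the factor `s + 1` in `X` makes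
room for the `n * (B + 1)` due dates. -/
theorem bounds_inputSize (I : GSP) : I.Bounds (3 * I.inputSize + 1)
    ((I.inputSize + 1) * (5 * I.inputSize + 3)) := by
  set s := I.inputSize with hs
  have hH := I.horizon_lt_two_pow
  rw [← hs] at hH
  have hn : I.n ≤ s := by rw [hs]; unfold inputSize; omega
  have hW : I.maxWeight < 2 ^ s := Nat.size_le.1 (by rw [hs]; unfold inputSize; omega)
  refine ⟨by nlinarith, by nlinarith, by nlinarith, ?_, fun j k h => ?_⟩
  · calc (I.horizon + 1) * 2 ^ (3 * s + 1) ≤ 2 ^ (2 * s + 1) * 2 ^ (3 * s + 1) :=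
        Nat.mul_le_mul_right _ hH
      _ = 2 ^ (5 * s + 2) := by rw [← pow_add]; congr 1; ring
      _ < 2 ^ ((s + 1) * (5 * s + 3)) := Nat.pow_lt_pow_right (by norm_num) (by nlinarith)
  · rw [← Nat.pow_lt_pow_iff_right (a := 2) (by norm_num)]
    refine (pow_le_of_doublingTime_ne_zero h).trans_lt ?_
    calc I.maxWeight * I.horizon < 2 ^ s * 2 ^ (2 * s + 1) := Nat.mul_lt_mul'' hW hH
      _ = 2 ^ (3 * s + 1) := by rw [← pow_add]; congr 1; ring

theorem bounded_inputMem (hr : ∀ i j, I.r i = I.r j) (hB : I.Bounds B X) :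
    Bounded X I.inputMem := by
  have hlt := hB.horizon_lt
  have hh := horizon_eq hr
  have hn := lt_two_pow_of_le hB.n_le
  have h0 : 0 < 2 ^ X := by positivity
  intro a i
  unfold inputMem
  split_ifs with h1 h2 h3 h4 h5 h6
  · exact hn
  · exact h0
  · rw [r_eq_release hr]; omega
  · exact h0
  · have := Finset.single_le_sum (f := I.size) (fun _ _ => Nat.zero_le _) (Finset.mem_range.2 h6)
    rw [size_eq I ⟨i, h6⟩] at this
    omega
  · exact h0
  · exact h0

end GSP

theorem mainTheorem2 :
    ∃ c : RAM.Prog, GSP.IsPolyTimeApprox {I : GSP | ∀ i j, I.r i = I.r j} 16 c := by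
  open Polynomial in
  refine ⟨GSP.approxProg, GSP.approxProg.timePoly.comp ((X + 1) * (5 * X + 3)), fun I hr => ?_⟩
  have hB := I.bounds_inputSize
  obtain ⟨m, t, hexec, ht, -, σ, hdesc, hfeas, hcost⟩ :=
    GSP.wp_approxProg hr hB (GSP.bounded_inputMem hr hB)
  refine ⟨m, t, σ, hexec, ?_, hdesc, hfeas, fun σ' hσ' => (hcost σ' hσ').trans ?_⟩
  · simpa [Polynomial.eval_comp, GSP.inputSize] using ht
  -- The analysis gives the factor 8, which is stronger than required.
  · omega
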